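/- A $\mathbb Z_2$-graded $C^*$-algebra is a pair $(\mathfrak A,\theta)$ of a unital $C^*$-algebra and a $*$-automorphism $\theta$ with $\theta^2=\mathrm{id}$; put $\mathfrak A_{\pm}=\{a:\theta(a)=\pm a\}$ (even and odd elements). Let $(\mathfrak A_1,\theta_1)$ and $(\mathfrak A_2,\theta_2)$ be $\mathbb Z_2$-graded $C^*$-algebras. Their algebraic Fermi product $\mathfrak A_1\,Ⓕ\,\mathfrak A_2$ is the algebraic tensor product $\mathfrak A_1\odot\mathfrak A_2$ with the product and involution that on homogeneous elements are given by $$(a_1\otimes a_2)(b_1\otimes b_2)=\varepsilon(a_2,b_1)\,a_1b_1\otimes a_2b_2,\qquad (a_1\otimes a_2)^*=\varepsilon(a_1,a_2)\,a_1^*\otimes a_2^*,$$ where $\varepsilon(x,y)=-1$ if $x$ and $y$ are both odd and $\varepsilon(x,y)=1$ otherwise. It is graded by $(\theta_1\,Ⓕ\,\theta_2)(a_1\otimes a_2)=\theta_1(a_1)\otimes\theta_2(a_2)$. A state $\omega$ of $\mathfrak A_i$ is even if $\omega\circ\theta_i=\omega$, and $\omega_1\times\omega_2$ denotes the linear functional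 with $(\omega_1\times\omega_2)(a_1\otimes a_2)=\omega_1(a_1)\omega_2(a_2)$. A GNS representation of a linear functional $\varphi$ on a unital $*$-algebra is a $*$-representation $\pi_\varphi$ by bounded operators on a Hilbert space with a cyclic vector $\xi$ such that $\varphi(x)=\langle\xi,\pi_\varphi(x)\xi\rangle$ for all $x$ (inner product linear in the second variable); it is unique up to unitary equivalence. A $C^*$-norm $\|\cdot\|_\beta$ on $\mathfrak A_1\,Ⓕ\,\mathfrak A_2$ (a submultiplicative norm with $\|x^*x\|_\beta=\|x\|_\beta^2$) is compatible if $\theta_1\,Ⓕ\,\theta_2$ extends to a $*$-automorphism of the completion of $\mathfrak A_1\,Ⓕ\,\mathfrak A_2$ with respect to $\|\cdot\|_\beta$. Theorem. For all even states $\omega_1$ of $\mathfrak A_1$ and $\omega_2$ of $\mathfrak A_2$ the functional $\omega_1\times\omega_2$ has a GNS representation $\pi_{\omega_1\times\omega_2}$. The spatial norm $$\|x\|_{\min}:=\sup\{\|\pi_{\omega_1\times\omega_2}(x)\| : \omega_1,\omega_2\text{ even states of }\mathfrak A_1,\mathfrak A_2\},\qquad x\in\mathfrak A_1\,Ⓕ\,\mathfrak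 A_2$$ (with $\sup\emptyset=0$), is the smallest compatible $C^*$-norm on $\mathfrak A_1\,Ⓕ\,\mathfrak A_2$: it is a compatible $C^*$-norm, and $\|x\|_{\min}\le\|x\|_\beta$ for every compatible $C^*$-norm $\|\cdot\|_\beta$ on $\mathfrak A_1\,Ⓕ\,\mathfrak A_2$ and every $x\in\mathfrak A_1\,Ⓕ\,\mathfrak A_2$. -/

import Mathlib

open scoped TensorProduct ComplexOrder

universe u v

noncomputable section

theorem zmod_two_cases : ∀ i : ZMod 2, i = 0 ∨ i = 1 := by decide

/-- A `ℤ₂`-grading of a (unital) C*-algebra `A`, given by an involutive `*`-automorphism. -/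
structure Z2Grading (A : Type u) [CStarAlgebra A] where
  /-- the grading automorphism -/
  theta : A ≃⋆ₐ[ℂ] A
  involutive : ∀ a : A, theta (theta a) = a

namespace Z2Grading

variable {A : Type u} [CStarAlgebra A] (g : Z2Grading A)

/-- The homogeneous components: `component 0` is the even part `{a | θ a = a}` and `component 1`
the odd part `{a | θ a = -a}`. -/
def component (i : ZMod 2) : Submodule ℂ A where
  carrier := {a | g.theta a = if i = 0 then a else -a}
  zero_mem' := by simp
  add_mem' := by
    intro a b ha hb
    simp only [Set.mem_ofPred_eq, map_add] at *
    split_ifs at * with h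
    · rw [ha, hb]
    · rw [ha, hb, neg_add]
  smul_mem' := by
    intro c a ha
    simp only [Set.mem_ofPred_eq, map_smul] at *
    split_ifs at * with h
    · rw [ha]
    · rw [ha, smul_neg]

/-- The grading automorphism as a linear map. -/
def thetaLin : A →ₗ[ℂ] A where
  toFun := g.theta
  map_add' := map_add g.theta
  map_smul' c a := map_smul g.theta c a

/-- The projection `(id ± θ) / 2` of `A` onto its homogeneous component of degree `i`. -/
def proj (i : ZMod 2) : A →ₗ[ℂ] A :=
  (2⁻¹ : ℂ) • (LinearMap.id + (if i = 0 then (1 : ℂ) else -1) • g.thetaLin)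

theorem mem_component {i : ZMod 2} {a : A} :
    a ∈ g.component i ↔ g.theta a = if i = 0 then a else -a := Iff.rfl

theorem proj_apply (i : ZMod 2) (a : A) :
    g.proj i a = (2⁻¹ : ℂ) • (a + (if i = 0 then (1 : ℂ) else -1) • g.theta a) := rfl

theorem proj_mem (i : ZMod 2) (a : A) : g.proj i a ∈ g.component i := by
  rw [mem_component, proj_apply]
  split_ifs <;> simp [g.involutive, add_comm, ← smul_neg]

theorem proj_of_mem {i : ZMod 2} {a : A} (ha : a ∈ g.component i) (j : ZMod 2) :
    g.proj j a = if j = i then a else 0 := by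
  rw [mem_component] at ha
  rw [proj_apply, ha]
  have h2 : (2⁻¹ : ℂ) • (a + a) = a := by rw [← two_smul ℂ a, smul_smul]; norm_num
  rcases zmod_two_cases i with rfl | rfl <;> rcases zmod_two_cases j with rfl | rfl <;> simp [h2]

theorem proj_zero_add_proj_one (a : A) : g.proj 0 a + g.proj 1 a = a := by
  have h2 : (2⁻¹ : ℂ) • (a + a) = a := by rw [← two_smul ℂ a, smul_smul]; norm_num
  rw [proj_apply, proj_apply, ← smul_add]
  simp only [if_true, one_ne_zero, if_false, one_smul, neg_smul]
  rw [show a + g.theta a + (a + -g.theta a) = a + a by abel, h2]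

theorem star_mem {i : ZMod 2} {a : A} (ha : a ∈ g.component i) : star a ∈ g.component i := by
  rw [mem_component] at *
  rw [map_star, ha]
  split_ifs <;> simp

/-- The projection onto a homogeneous component, as a map into this component. -/
def projTo (i : ZMod 2) : A →ₗ[ℂ] g.component i := (g.proj i).codRestrict _ (g.proj_mem i)

theorem coe_projTo (i : ZMod 2) (a : A) : (g.projTo i a : A) = g.proj i a := rfl

theorem projTo_coe {i : ZMod 2} (a : g.component i) (j : ZMod 2) :
    g.projTo j (a : A) = if h : j = i then h ▸ a else 0 := by
  ext
  rw [coe_projTo, g.proj_of_mem a.2]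
  split_ifs with h
  · subst h
    rfl
  · rfl

/-- The two homogeneous components make `A` a `ℤ₂`-graded algebra in Mathlib's sense. -/
instance : GradedAlgebra g.component where
  one_mem := by simp [mem_component]
  mul_mem := by
    intro i j a b ha hb
    rw [mem_component] at *
    rw [map_mul, ha, hb]
    rcases zmod_two_cases i with rfl | rfl <;> rcases zmod_two_cases j with rfl | rfl <;> simp [show (1 : ZMod 2) + 1 = 0 from rfl]
  decompose' a := DirectSum.of (fun i => g.component i) 0 (g.projTo 0 a) +
    DirectSum.of (fun i => g.component i) 1 (g.projTo 1 a)
  left_inv a := by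
    simp [proj_zero_add_proj_one, coe_projTo]
  right_inv x := by
    induction x using DirectSum.induction_on with
    | zero => simp
    | of i x =>
      simp only [DirectSum.coeAddMonoidHom_of, projTo_coe]
      rcases zmod_two_cases i with rfl | rfl <;> simp
    | add x y hx hy =>
      conv_rhs => rw [← hx, ← hy]
      simp only [map_add]
      abel

end Z2Grading

/-- The sign `ε(i, j)`: it is `-1` if both degrees are odd, and `1` otherwise. -/
def koszulSign (i j : ZMod 2) : ℂ := if i = 1 ∧ j = 1 then -1 else 1

variable {A₁ : Type u} {A₂ : Type v} [CStarAlgebra A₁] [CStarAlgebra A₂]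

/-- The algebraic Fermi (graded) tensor product of two `ℤ₂`-graded C*-algebras: the linear space
`A₁ ⊗ A₂` with `(a ⊗ b) (a' ⊗ b') = ε(∂b, ∂a') (a a' ⊗ b b')` for homogeneous `b`, `a'`. -/
abbrev FermiProduct (g₁ : Z2Grading A₁) (g₂ : Z2Grading A₂) : Type (max u v) :=
  GradedTensorProduct ℂ g₁.component g₂.component

namespace FermiProduct

variable (g₁ : Z2Grading A₁) (g₂ : Z2Grading A₂)

/-- The linear identification of `A₁ ⊗ A₂` with the Fermi product. -/
abbrev ofTensor : A₁ ⊗[ℂ] A₂ ≃ₗ[ℂ] FermiProduct g₁ g₂ :=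
  GradedTensorProduct.of ℂ g₁.component g₂.component

/-- The linear map that multiplies the component of bidegree `(i, j)` by `ε(i, j)`. -/
def twist : A₁ ⊗[ℂ] A₂ →ₗ[ℂ] A₁ ⊗[ℂ] A₂ :=
  ∑ i : ZMod 2, ∑ j : ZMod 2, koszulSign i j • TensorProduct.map (g₁.proj i) (g₂.proj j)

/-- The involution `x* = ∑ ε(i, j) (x_{i,j})*` of the Fermi product. -/
instance : Star (FermiProduct g₁ g₂) where
  star x := ofTensor g₁ g₂ (star (twist g₁ g₂ ((ofTensor g₁ g₂).symm x)))

theorem star_def (x : FermiProduct g₁ g₂) :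
    star x = ofTensor g₁ g₂ (star (twist g₁ g₂ ((ofTensor g₁ g₂).symm x))) := rfl

variable {g₁ g₂}

theorem star_tmul_of_mem {i j : ZMod 2} {a : A₁} {b : A₂}
    (ha : a ∈ g₁.component i) (hb : b ∈ g₂.component j) :
    star (ofTensor g₁ g₂ (a ⊗ₜ b)) = koszulSign i j • ofTensor g₁ g₂ (star a ⊗ₜ star b) := by
  rw [star_def, ← LinearEquiv.map_smul]
  congr 1
  rw [LinearEquiv.symm_apply_apply]
  have hs : star (koszulSign i j) = koszulSign i j := by
    unfold koszulSign
    split_ifs <;> simp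
  have ht : twist g₁ g₂ (a ⊗ₜ b) = koszulSign i j • (a ⊗ₜ b) := by
    simp only [twist, LinearMap.sum_apply, LinearMap.smul_apply, TensorProduct.map_tmul,
      g₁.proj_of_mem ha, g₂.proj_of_mem hb]
    rw [Finset.sum_eq_single i, Finset.sum_eq_single j]
    · simp
    · intro k _ hk
      simp [hk]
    · simp
    · intro k _ hk
      simp [hk]
    · simp
  rw [ht, star_smul, hs, TensorProduct.star_tmul]

theorem mul_tmul_of_mem {j k : ZMod 2} (a : A₁) {b : A₂} {c : A₁} (d : A₂)
    (hb : b ∈ g₂.component j) (hc : c ∈ g₁.component k) :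
    ofTensor g₁ g₂ (a ⊗ₜ b) * ofTensor g₁ g₂ (c ⊗ₜ d) =
      koszulSign j k • ofTensor g₁ g₂ ((a * c) ⊗ₜ (b * d)) := by
  have h := GradedTensorProduct.tmul_coe_mul_coe_tmul (R := ℂ) g₁.component g₂.component a
    ⟨b, hb⟩ ⟨c, hc⟩ d
  simp only [GradedTensorProduct.tmul] at h
  rw [h]
  rcases zmod_two_cases j with rfl | rfl <;> rcases zmod_two_cases k with rfl | rfl <;> simp [koszulSign]

/-- Induction over homogeneous elementary tensors. -/
theorem induction_homogeneous {P : FermiProduct g₁ g₂ → Prop}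
    (hadd : ∀ x y, P x → P y → P (x + y))
    (hmul : ∀ (i j : ZMod 2) (a : A₁) (b : A₂), a ∈ g₁.component i → b ∈ g₂.component j →
      P (ofTensor g₁ g₂ (a ⊗ₜ b))) (x : FermiProduct g₁ g₂) : P x := by
  obtain ⟨t, rfl⟩ := (ofTensor g₁ g₂).surjective x
  induction t using TensorProduct.induction_on with
  | zero =>
    have := hmul 0 0 0 0 (Submodule.zero_mem _) (Submodule.zero_mem _)
    simpa using this
  | tmul a b =>
    rw [← g₁.proj_zero_add_proj_one a, ← g₂.proj_zero_add_proj_one b, TensorProduct.add_tmul,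
      TensorProduct.tmul_add, TensorProduct.tmul_add]
    simp only [map_add]
    refine hadd _ _ (hadd _ _ ?_ ?_) (hadd _ _ ?_ ?_) <;>
      exact hmul _ _ _ _ (g₁.proj_mem _ _) (g₂.proj_mem _ _)
  | add x y hx hy =>
    rw [map_add]
    exact hadd _ _ hx hy

theorem star_add' (x y : FermiProduct g₁ g₂) : star (x + y) = star x + star y := by
  simp [star_def]

theorem star_smul' (c : ℂ) (x : FermiProduct g₁ g₂) : star (c • x) = star c • star x := by
  simp [star_def, star_smul]

/-- The Fermi product is a `*`-algebra. -/
instance : StarRing (FermiProduct g₁ g₂) where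
  star_involutive x := by
    induction x using induction_homogeneous with
    | hadd x y hx hy => rw [star_add', star_add', hx, hy]
    | hmul i j a b ha hb =>
      rw [star_tmul_of_mem ha hb, star_smul', star_tmul_of_mem (g₁.star_mem ha) (g₂.star_mem hb),
        star_star, star_star, smul_smul]
      rcases zmod_two_cases i with rfl | rfl <;> rcases zmod_two_cases j with rfl | rfl <;> simp [koszulSign]
  star_mul x y := by
    induction x using induction_homogeneous with
    | hadd x x' hx hx' => rw [add_mul, star_add', star_add', hx, hx', mul_add]
    | hmul i j a b ha hb =>
      induction y using induction_homogeneous with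
      | hadd y y' hy hy' => rw [mul_add, star_add', star_add', hy, hy', add_mul]
      | hmul k l c d hc hd =>
        rw [mul_tmul_of_mem a d hb hc, star_smul',
          star_tmul_of_mem (SetLike.mul_mem_graded ha hc) (SetLike.mul_mem_graded hb hd),
          star_tmul_of_mem ha hb, star_tmul_of_mem hc hd, smul_mul_smul_comm,
          mul_tmul_of_mem _ _ (g₂.star_mem hd) (g₁.star_mem ha), star_mul, star_mul, smul_smul,
          smul_smul]
        congr 1
        rcases zmod_two_cases i with rfl | rfl <;> rcases zmod_two_cases j with rfl | rfl <;> rcases zmod_two_cases k with rfl | rfl <;> rcases zmod_two_cases l with rfl | rfl <;>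
          simp [koszulSign, show (1 : ZMod 2) + 1 = 0 from rfl]
  star_add := star_add'

instance : StarModule ℂ (FermiProduct g₁ g₂) where
  star_smul := star_smul'

variable (g₁ g₂) in
/-- The product grading `θ₁ Ⓕ θ₂`, `a₁ ⊗ a₂ ↦ θ₁ a₁ ⊗ θ₂ a₂`. -/
def grading : FermiProduct g₁ g₂ →ₗ[ℂ] FermiProduct g₁ g₂ :=
  (ofTensor g₁ g₂).toLinearMap ∘ₗ
    TensorProduct.map g₁.thetaLin g₂.thetaLin ∘ₗ
      (ofTensor g₁ g₂).symm.toLinearMap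

end FermiProduct

/-- An even state of a `ℤ₂`-graded unital C*-algebra: a positive, normalized linear functional
that is invariant under the grading. -/
structure EvenState {A : Type u} [CStarAlgebra A] (g : Z2Grading A) where
  /-- the underlying linear functional -/
  toFun : A →ₗ[ℂ] ℂ
  nonneg : ∀ a : A, 0 ≤ toFun (star a * a)
  map_one : toFun 1 = 1
  even : ∀ a : A, toFun (g.theta a) = toFun a

namespace EvenState

variable {g₁ : Z2Grading A₁} {g₂ : Z2Grading A₂}

/-- The product functional `ω₁ × ω₂`, `a₁ ⊗ a₂ ↦ ω₁ a₁ * ω₂ a₂`. -/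
def prod (ω₁ : EvenState g₁) (ω₂ : EvenState g₂) : FermiProduct g₁ g₂ →ₗ[ℂ] ℂ :=
  LinearMap.mul' ℂ ℂ ∘ₗ TensorProduct.map ω₁.toFun ω₂.toFun ∘ₗ
    (FermiProduct.ofTensor g₁ g₂).symm.toLinearMap

end EvenState

/-- A GNS representation of a linear functional `φ` on a unital `*`-algebra `B`: a
`*`-representation `π` by bounded operators on a Hilbert space with a cyclic vector `ξ` such that
`φ x = ⟨ξ, π x ξ⟩`. It is unique up to unitary equivalence. -/
structure GNSRep {B : Type u} [Ring B] [StarRing B] [Algebra ℂ B] (φ : B →ₗ[ℂ] ℂ) where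
  /-- the Hilbert space -/
  H : Type u
  [instNormed : NormedAddCommGroup H]
  [instInner : InnerProductSpace ℂ H]
  [instComplete : CompleteSpace H]
  /-- the representation -/
  π : B →⋆ₐ[ℂ] (H →L[ℂ] H)
  /-- the cyclic vector -/
  ξ : H
  cyclic : DenseRange fun x : B => π x ξ
  inner_eq : ∀ x : B, inner ℂ ξ (π x ξ) = φ x

attribute [instance] GNSRep.instNormed GNSRep.instInner GNSRep.instComplete

namespace FermiProduct

variable (g₁ : Z2Grading A₁) (g₂ : Z2Grading A₂)

/-- The spatial norm: the supremum of `‖π x‖` over the GNS representations `π` of the products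
`ω₁ × ω₂` of even states. -/
def spatialNorm (x : FermiProduct g₁ g₂) : ℝ :=
  sSup {r : ℝ | ∃ (ω₁ : EvenState g₁) (ω₂ : EvenState g₂) (R : GNSRep (ω₁.prod ω₂)), r = ‖R.π x‖}

end FermiProduct

/-- A C*-norm on a `*`-algebra. -/
structure IsCStarNorm {B : Type u} [Ring B] [StarRing B] [Algebra ℂ B] (N : B → ℝ) : Prop where
  add_le : ∀ x y, N (x + y) ≤ N x + N y
  smul_eq : ∀ (c : ℂ) (x : B), N (c • x) = ‖c‖ * N x
  eq_zero : ∀ x, N x = 0 → x = 0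
  mul_le : ∀ x y, N (x * y) ≤ N x * N y
  star_mul_self : ∀ x, N (star x * x) = N x ^ 2

/-- A completion of the `*`-algebra `B` for the norm `N`: a C*-algebra with a `*`-homomorphism
from `B` that has dense range and carries the norm to `N`. -/
structure CStarCompletion {B : Type u} [Ring B] [StarRing B] [Algebra ℂ B] (N : B → ℝ) where
  /-- the completed C*-algebra -/
  C : Type u
  [instCStar : CStarAlgebra C]
  /-- the canonical map -/
  ι : B →⋆ₐ[ℂ] C
  norm_ι : ∀ x, ‖ι x‖ = N x
  dense : DenseRange ι

attribute [instance] CStarCompletion.instCStar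

/-- A norm on the Fermi product is a compatible C*-norm if it is a C*-norm and the product grading
extends to a `*`-automorphism of the completion. -/
structure IsCompatibleNorm {g₁ : Z2Grading A₁} {g₂ : Z2Grading A₂} (N : FermiProduct g₁ g₂ → ℝ) :
    Prop where
  isCStarNorm : IsCStarNorm N
  extends_grading : ∃ (K : CStarCompletion N) (Θ : K.C ≃⋆ₐ[ℂ] K.C),
    ∀ x, Θ (K.ι x) = K.ι (FermiProduct.grading g₁ g₂ x)

end

/-!
The GNS representation of `ω₁ × ω₂` acts on the tensor product of the two GNS spaces, and even
product states separate the points of the Fermi product by slicing.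

For minimality it suffices to show `|(ω₁ × ω₂)(x)| ≤ ‖x‖_β`, and by Krein–Milman only for `ω₁`
extreme among the even states. Averaging maps states onto even states, so
`ω₁ = (ψ + ψ ∘ θ₁) / 2` for a pure state `ψ`. In the completion the images `i(A₁)` and `j(A₂₊)`
commute and `i(a) j(b) ≠ 0` for `a, b ≠ 0`, so `ψ` and `ω₂|A₂₊` have a joint extension `Ω`. The
functional `F_b(a) = Ω(i(a) j(b))` defines a bounded form on the GNS space of `ψ` for even `b`,
hence is `ω₂(b) ψ` by purity; for odd `b` it is a bounded form between the GNS spaces of `ψ` and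
`ψ ∘ θ₁`, and it vanishes on odd `a`. Hence the average of `Ω` under the grading of the completion
restricts to `ω₁ × ω₂`.
-/

noncomputable section

/-! ### Positive functionals and the GNS construction -/

section PositiveFunctional

theorem exists_star_mul_self_add_star_mul_self_eq {A : Type*} [CStarAlgebra A] (a : A) :
    ∃ c : A, star a * a + star c * c = ((‖a‖ ^ 2 : ℝ) : ℂ) • (1 : A) := by
  let _ := CStarAlgebra.spectralOrder A
  have _ := CStarAlgebra.spectralOrderedRing A
  obtain ⟨c, hc⟩ := CStarAlgebra.nonneg_iff_eq_star_mul_self.mp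
    (sub_nonneg.mpr (CStarAlgebra.star_mul_le_algebraMap_norm_sq (a := a)))
  refine ⟨c, ?_⟩
  rw [← hc, add_sub_cancel, Algebra.algebraMap_eq_smul_one, Complex.coe_smul]

/-- A positive linear functional on a `*`-algebra. Mathlib's bundled `A →ₚ[ℂ] ℂ` needs an order on
the algebra, which the Fermi product does not carry. -/
def IsPositiveFunctional {B : Type*} [Ring B] [StarRing B] [Algebra ℂ B] (φ : B →ₗ[ℂ] ℂ) : Prop :=
  ∀ x, 0 ≤ φ (star x * x)

/-- The GNS seminorm `x ↦ φ(x* x)^{1/2}` of a positive functional `φ`. -/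
def gnsNorm {B : Type*} [Ring B] [StarRing B] [Algebra ℂ B] (φ : B →ₗ[ℂ] ℂ) (x : B) : ℝ :=
  √(φ (star x * x)).re

theorem gnsNorm_nonneg {B : Type*} [Ring B] [StarRing B] [Algebra ℂ B] (φ : B →ₗ[ℂ] ℂ) (x : B) :
    0 ≤ gnsNorm φ x :=
  Real.sqrt_nonneg _

namespace IsPositiveFunctional

section StarAlgebra

variable {B : Type*} [Ring B] [StarRing B] [Algebra ℂ B] {φ : B →ₗ[ℂ] ℂ}

theorem sq_gnsNorm (hφ : IsPositiveFunctional φ) (x : B) :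
    gnsNorm φ x ^ 2 = (φ (star x * x)).re :=
  Real.sq_sqrt (Complex.nonneg_iff.mp (hφ x)).1

theorem map_star_mul_self (hφ : IsPositiveFunctional φ) (x : B) :
    φ (star x * x) = ((gnsNorm φ x ^ 2 : ℝ) : ℂ) := by
  rw [hφ.sq_gnsNorm]
  exact Complex.eq_re_of_ofReal_le (hφ x)

theorem im_map_add_map_star (hφ : IsPositiveFunctional φ) (y : B) :
    (φ y + φ (star y)).im = 0 := by
  have h0 := (Complex.nonneg_iff.mp (hφ y)).2
  have h1 := (Complex.nonneg_iff.mp (hφ 1)).2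
  have h2 := (Complex.nonneg_iff.mp (hφ (1 + y))).2
  simp only [star_add, star_one, add_mul, mul_add, one_mul, mul_one, map_add,
    Complex.add_im] at h0 h1 h2 ⊢
  linarith

protected theorem map_star [StarModule ℂ B] (hφ : IsPositiveFunctional φ) (x : B) :
    φ (star x) = star (φ x) := by
  have h1 := hφ.im_map_add_map_star x
  have h2 := hφ.im_map_add_map_star (Complex.I • x)
  simp only [star_smul, map_smul, smul_eq_mul, Complex.add_im, Complex.mul_im, Complex.star_def,
    Complex.conj_I, Complex.neg_re, Complex.neg_im, Complex.I_re, Complex.I_im] at h1 h2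
  apply Complex.ext <;> simp only [Complex.star_def, Complex.conj_re, Complex.conj_im] <;>
    linarith

end StarAlgebra

end IsPositiveFunctional

/-- The algebra `B` regarded as a semi-inner product space by means of the positive functional `φ`;
the GNS space is its completion. -/
def PreGNSSpace {B : Type*} [Ring B] [StarRing B] [Algebra ℂ B] (φ : B →ₗ[ℂ] ℂ)
    (_ : IsPositiveFunctional φ) := B

namespace PreGNSSpace

variable {B : Type*} [Ring B] [StarRing B] [Algebra ℂ B] {φ : B →ₗ[ℂ] ℂ}
  {hφ : IsPositiveFunctional φ}

instance : AddCommGroup (PreGNSSpace φ hφ) := inferInstanceAs (AddCommGroup B)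
instance : Module ℂ (PreGNSSpace φ hφ) := inferInstanceAs (Module ℂ B)

variable (hφ) in
/-- The identification of the algebra `B` with its copy `PreGNSSpace φ hφ`. -/
def equiv : B ≃ₗ[ℂ] PreGNSSpace φ hφ := LinearEquiv.refl ℂ _

variable [StarModule ℂ B]

variable (hφ) in
/-- The semi-inner product `⟨x, y⟩ = φ(x* y)`. -/
abbrev core : PreInnerProductSpace.Core ℂ (PreGNSSpace φ hφ) where
  inner x y := φ (star ((equiv hφ).symm x) * (equiv hφ).symm y)
  conj_inner_symm x y := by rw [← Complex.star_def, ← hφ.map_star, star_mul, star_star]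
  re_inner_nonneg x := (Complex.nonneg_iff.mp (hφ _)).1
  add_left _ _ _ := by rw [map_add, star_add, add_mul, map_add]
  smul_left _ _ _ := by simp

instance : SeminormedAddCommGroup (PreGNSSpace φ hφ) :=
  InnerProductSpace.Core.toSeminormedAddCommGroup (c := core hφ)

instance : InnerProductSpace ℂ (PreGNSSpace φ hφ) := InnerProductSpace.ofCore (core hφ)

theorem inner_equiv (x y : B) : inner ℂ (equiv hφ x) (equiv hφ y) = φ (star x * y) := rfl

end PreGNSSpace

namespace IsPositiveFunctional

theorem norm_map_star_mul_le {B : Type*} [Ring B] [StarRing B] [Algebra ℂ B] [StarModule ℂ B]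
    {φ : B →ₗ[ℂ] ℂ} (hφ : IsPositiveFunctional φ) (x y : B) :
    ‖φ (star x * y)‖ ≤ gnsNorm φ x * gnsNorm φ y :=
  norm_inner_le_norm (𝕜 := ℂ) (PreGNSSpace.equiv hφ x) (PreGNSSpace.equiv hφ y)

theorem gnsNorm_add_le {B : Type*} [Ring B] [StarRing B] [Algebra ℂ B] [StarModule ℂ B]
    {φ : B →ₗ[ℂ] ℂ} (hφ : IsPositiveFunctional φ) (x y : B) :
    gnsNorm φ (x + y) ≤ gnsNorm φ x + gnsNorm φ y :=
  norm_add_le (PreGNSSpace.equiv hφ x) (PreGNSSpace.equiv hφ y)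

variable {A : Type*} [CStarAlgebra A]

/-- `‖a‖² - a* a` is a square `c* c`, and `φ (y* (j c)* (j c) y) ≥ 0`. -/
theorem gnsNorm_map_mul_le {B : Type*} [Ring B] [StarRing B] [Algebra ℂ B] {φ : B →ₗ[ℂ] ℂ}
    (hφ : IsPositiveFunctional φ) (j : A →⋆ₐ[ℂ] B) (a : A) (y : B) :
    gnsNorm φ (j a * y) ≤ ‖a‖ * gnsNorm φ y := by
  obtain ⟨c, hc⟩ := exists_star_mul_self_add_star_mul_self_eq a
  have hsum : φ (star (j a * y) * (j a * y)) + φ (star (j c * y) * (j c * y)) =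
      ((‖a‖ ^ 2 : ℝ) : ℂ) * φ (star y * y) := by
    have h := congrArg (fun z => φ (star y * j z * y)) hc
    simpa only [map_add, map_mul, map_star, map_smul, map_one, mul_add, add_mul, mul_smul_comm,
      smul_mul_assoc, mul_one, smul_eq_mul, star_mul, mul_assoc] using h
  rw [hφ.map_star_mul_self, hφ.map_star_mul_self, hφ.map_star_mul_self] at hsum
  norm_cast at hsum
  refine abs_le_of_sq_le_sq' ?_ (mul_nonneg (norm_nonneg a) (gnsNorm_nonneg φ y)) |>.2
  rw [mul_pow]
  linarith [sq_nonneg (gnsNorm φ (j c * y))]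

variable {φ : A →ₗ[ℂ] ℂ}

theorem gnsNorm_mul_le (hφ : IsPositiveFunctional φ) (a y : A) :
    gnsNorm φ (a * y) ≤ ‖a‖ * gnsNorm φ y :=
  hφ.gnsNorm_map_mul_le (StarAlgHom.id ℂ A) a y

theorem gnsNorm_one (h1 : φ 1 = 1) : gnsNorm φ 1 = 1 := by simp [gnsNorm, h1]

theorem gnsNorm_le_norm (hφ : IsPositiveFunctional φ) (h1 : φ 1 = 1) (a : A) :
    gnsNorm φ a ≤ ‖a‖ := by
  simpa [gnsNorm_one h1] using hφ.gnsNorm_mul_le a 1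

theorem norm_map_le_norm (hφ : IsPositiveFunctional φ) (h1 : φ 1 = 1) (a : A) : ‖φ a‖ ≤ ‖a‖ := by
  have h := hφ.norm_map_star_mul_le 1 a
  rw [star_one, one_mul, gnsNorm_one h1, one_mul] at h
  exact h.trans (hφ.gnsNorm_le_norm h1 a)

end IsPositiveFunctional

end PositiveFunctional

theorem continuousLinearMap_eq_of_denseRange {ι E F : Type*} [NormedAddCommGroup E]
    [NormedSpace ℂ E] [NormedAddCommGroup F] [NormedSpace ℂ F] {e : ι → E} (he : DenseRange e)
    {S T : E →L[ℂ] F} (h : ∀ i, S (e i) = T (e i)) : S = T :=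
  DFunLike.coe_injective (he.equalizer S.continuous T.continuous (funext h))

namespace GNSRep

variable {B : Type u} [Ring B] [StarRing B] [Algebra ℂ B] {φ : B →ₗ[ℂ] ℂ}

section Construction

variable {H : Type u} [NormedAddCommGroup H] [InnerProductSpace ℂ H]

/-- The operator `vec y ↦ vec (x * y)` on the Hilbert space `H` densely spanned by the vectors
`vec y`. -/
def leftMul [CompleteSpace H] (vec : B →ₗ[ℂ] H) (x : B) : H →L[ℂ] H :=
  (vec ∘ₗ LinearMap.mulLeft ℂ x).extendOfNorm vec

variable {vec : B →ₗ[ℂ] H}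

theorem norm_vec (hinner : ∀ x y, inner ℂ (vec x) (vec y) = φ (star x * y)) (x : B) :
    ‖vec x‖ = gnsNorm φ x := by
  rw [gnsNorm, ← hinner]
  exact norm_eq_sqrt_re_inner (𝕜 := ℂ) _

theorem leftMul_vec [CompleteSpace H] (hvec : DenseRange vec)
    (hinner : ∀ x y, inner ℂ (vec x) (vec y) = φ (star x * y))
    (hbdd : ∀ x, ∃ C, ∀ y, gnsNorm φ (x * y) ≤ C * gnsNorm φ y) (x y : B) :
    leftMul vec x (vec y) = vec (x * y) :=
  LinearMap.extendOfNorm_eq hvec (by simpa [norm_vec hinner] using hbdd x) y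

/-- A GNS representation from a densely defined GNS vector map. -/
def ofVec [CompleteSpace H] (hvec : DenseRange vec)
    (hinner : ∀ x y, inner ℂ (vec x) (vec y) = φ (star x * y))
    (hbdd : ∀ x, ∃ C, ∀ y, gnsNorm φ (x * y) ≤ C * gnsNorm φ y) : GNSRep φ where
  H := H
  π :=
    have hmul := leftMul_vec hvec hinner hbdd
    have hext {S T : H →L[ℂ] H} := continuousLinearMap_eq_of_denseRange (S := S) (T := T) hvec
    { toFun := leftMul vec
      map_one' := hext fun z => by simp [hmul]
      map_mul' x y := hext fun z => by simp [hmul, mul_assoc]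
      map_zero' := hext fun z => by simp [hmul]
      map_add' x y := hext fun z => by simp [hmul, add_mul]
      commutes' c := hext fun z => by simp [hmul, Algebra.algebraMap_eq_smul_one]
      map_star' x := hext fun z => hvec.eq_of_inner_right ℂ fun w => by
        rw [ContinuousLinearMap.star_eq_adjoint, ContinuousLinearMap.adjoint_inner_right]
        simp [hmul, hinner, mul_assoc] }
  ξ := vec 1
  cyclic := by simpa [leftMul_vec hvec hinner hbdd] using hvec
  inner_eq x := by simp [leftMul_vec hvec hinner hbdd, hinner]

open PreGNSSpace in
/-- The Gelfand–Naimark–Segal construction for a positive functional on a `*`-algebra whose left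
multiplications are bounded for the GNS seminorm. -/
def ofIsPositiveFunctional [StarModule ℂ B] (hφ : IsPositiveFunctional φ)
    (hbdd : ∀ x, ∃ C, ∀ y, gnsNorm φ (x * y) ≤ C * gnsNorm φ y) : GNSRep φ :=
  ofVec (vec := (UniformSpace.Completion.toComplL (𝕜 := ℂ)).toLinearMap ∘ₗ (equiv hφ).toLinearMap)
    (UniformSpace.Completion.denseRange_coe.comp (equiv hφ).surjective.denseRange
      (UniformSpace.Completion.continuous_coe _))
    (fun x y => by simp [inner_equiv]) hbdd

/-- The GNS representation of a positive functional on a C*-algebra. -/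
def ofCStarAlgebra {A : Type u} [CStarAlgebra A] {φ : A →ₗ[ℂ] ℂ} (hφ : IsPositiveFunctional φ) :
    GNSRep φ :=
  ofIsPositiveFunctional hφ fun x => ⟨_, hφ.gnsNorm_mul_le x⟩

end Construction

/-- The canonical map `x ↦ π(x) ξ` from the algebra to the GNS space. -/
def orbit (R : GNSRep φ) : B →ₗ[ℂ] R.H where
  toFun x := R.π x R.ξ
  map_add' x y := by simp
  map_smul' c x := by simp

variable (R : GNSRep φ)

theorem orbit_one : R.orbit 1 = R.ξ := by simp [orbit]

theorem denseRange_orbit : DenseRange R.orbit := R.cyclic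

theorem π_orbit (x y : B) : R.π x (R.orbit y) = R.orbit (x * y) := by
  simp [orbit]

theorem inner_π_right (x : B) (v w : R.H) :
    inner ℂ v (R.π x w) = inner ℂ (R.π (star x) v) w := by
  rw [map_star, ContinuousLinearMap.star_eq_adjoint, ContinuousLinearMap.adjoint_inner_left]

theorem inner_orbit (x y : B) : inner ℂ (R.orbit x) (R.orbit y) = φ (star x * y) := by
  rw [← R.inner_eq, map_mul, mul_apply_eq_comp, inner_π_right, star_star]
  rfl

theorem norm_orbit (x : B) : ‖R.orbit x‖ = gnsNorm φ x := norm_vec R.inner_orbit x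

theorem norm_π_le {x : B} {C : ℝ} (hC : 0 ≤ C)
    (h : ∀ y, gnsNorm φ (x * y) ≤ C * gnsNorm φ y) : ‖R.π x‖ ≤ C := by
  refine ContinuousLinearMap.opNorm_le_bound _ hC fun v => ?_
  induction v using R.denseRange_orbit.induction_on with
  | hp => exact isClosed_le (by fun_prop) (by fun_prop)
  | ih y => simpa only [π_orbit, norm_orbit] using h y

theorem gnsNorm_mul_le (x y : B) : gnsNorm φ (x * y) ≤ ‖R.π x‖ * gnsNorm φ y := by
  rw [← R.norm_orbit, ← R.norm_orbit, ← R.π_orbit]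
  exact (R.π x).le_opNorm _

theorem norm_π_eq (R R' : GNSRep φ) (x : B) : ‖R.π x‖ = ‖R'.π x‖ :=
  le_antisymm (R.norm_π_le (norm_nonneg _) (R'.gnsNorm_mul_le x))
    (R'.norm_π_le (norm_nonneg _) (R.gnsNorm_mul_le x))

theorem continuousLinearMap_ext {X Y : R.H →L[ℂ] R.H}
    (h : ∀ a c, inner ℂ (R.orbit a) (X (R.orbit c)) = inner ℂ (R.orbit a) (Y (R.orbit c))) :
    X = Y :=
  continuousLinearMap_eq_of_denseRange R.denseRange_orbit fun c =>
    R.denseRange_orbit.eq_of_inner_right ℂ fun a => h a c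

end GNSRep

/-! ### States -/

section ContractiveFunctional

variable {C : Type*} [CStarAlgebra C]

theorem norm_one_le_one : ‖(1 : C)‖ ≤ 1 := IsStarProjection.norm_le _ (.one C)

theorem norm_add_mul_I_smul_one_sq_le {h : C} (hh : IsSelfAdjoint h) (t : ℝ) :
    ‖h + (t * Complex.I) • (1 : C)‖ ^ 2 ≤ ‖h‖ ^ 2 + t ^ 2 := by
  have hmul : star (h + (t * Complex.I) • (1 : C)) * (h + (t * Complex.I) • (1 : C)) =
      h * h + ((t ^ 2 : ℝ) : ℂ) • (1 : C) := by
    have hstar : star (h + (t * Complex.I) • (1 : C)) = h - (t * Complex.I) • (1 : C) := by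
      simp [hh.star_eq, sub_eq_add_neg]
    have hI : (t * Complex.I) * (t * Complex.I) = -((t ^ 2 : ℝ) : ℂ) := by
      push_cast
      linear_combination (t : ℂ) ^ 2 * Complex.I_mul_I
    rw [hstar, sub_mul, mul_add, mul_add, smul_mul_smul_comm, hI, smul_mul_assoc, mul_smul_comm]
    simp only [one_mul, mul_one]
    module
  rw [sq, ← CStarRing.norm_star_mul_self, hmul]
  calc ‖h * h + ((t ^ 2 : ℝ) : ℂ) • (1 : C)‖ ≤ ‖h‖ * ‖h‖ + t ^ 2 * ‖(1 : C)‖ := by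
        refine norm_add_le_of_le (norm_mul_le h h) ?_
        rw [norm_smul, Complex.norm_real, Real.norm_of_nonneg (sq_nonneg t)]
    _ ≤ ‖h‖ ^ 2 + t ^ 2 := by nlinarith [sq_nonneg t, norm_one_le_one (C := C)]

variable {Ω : C →ₗ[ℂ] ℂ}

theorem im_map_eq_zero_of_contractive (hΩ : ∀ x, ‖Ω x‖ ≤ ‖x‖) (h1 : Ω 1 = 1) {h : C}
    (hh : IsSelfAdjoint h) : (Ω h).im = 0 := by
  have hbound (t : ℝ) : ((Ω h).im + t) ^ 2 ≤ ‖h‖ ^ 2 + t ^ 2 := by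
    refine le_trans ?_ (norm_add_mul_I_smul_one_sq_le hh t)
    have him : (Ω (h + (t * Complex.I) • (1 : C))).im = (Ω h).im + t := by simp [h1]
    rw [← him, ← sq_abs]
    gcongr
    exact (Complex.abs_im_le_norm _).trans (hΩ _)
  by_contra hne
  have ht := hbound ((‖h‖ ^ 2 + 1) / (2 * (Ω h).im))
  have hcancel : 2 * (Ω h).im * ((‖h‖ ^ 2 + 1) / (2 * (Ω h).im)) = ‖h‖ ^ 2 + 1 := by
    field_simp
  nlinarith [sq_nonneg (Ω h).im]

theorem isPositiveFunctional_of_contractive (hΩ : ∀ x, ‖Ω x‖ ≤ ‖x‖) (h1 : Ω 1 = 1) :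
    IsPositiveFunctional Ω := by
  intro x
  let _ := CStarAlgebra.spectralOrder C
  have _ := CStarAlgebra.spectralOrderedRing C
  rw [Complex.nonneg_iff]
  refine ⟨?_, (im_map_eq_zero_of_contractive hΩ h1 (.star_mul_self x)).symm⟩
  have hnonneg : 0 ≤ algebraMap ℝ C (‖x‖ ^ 2) - star x * x :=
    sub_nonneg.mpr CStarAlgebra.star_mul_le_algebraMap_norm_sq
  have hnorm : ‖algebraMap ℝ C (‖x‖ ^ 2) - star x * x‖ ≤ ‖x‖ ^ 2 :=
    (CStarAlgebra.norm_le_iff_le_algebraMap _ (sq_nonneg ‖x‖) hnonneg).mpr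
      (sub_le_self _ (star_mul_self_nonneg x))
  have hre := (Complex.re_le_norm _).trans ((hΩ _).trans hnorm)
  rw [map_sub, Algebra.algebraMap_eq_smul_one, ← Complex.coe_smul, map_smul, h1, smul_eq_mul,
    mul_one, Complex.sub_re, Complex.ofReal_re] at hre
  linarith

end ContractiveFunctional

/-- The trivial grading, for which every element is even. -/
def Z2Grading.trivial (A : Type u) [CStarAlgebra A] : Z2Grading A where
  theta := StarAlgEquiv.refl ℂ A
  involutive _ := rfl

/-- States of a C*-algebra, encoded as the even states for the trivial grading so that what is
proved for even states applies to all states. -/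
abbrev State (A : Type u) [CStarAlgebra A] := EvenState (Z2Grading.trivial A)

namespace EvenState

variable {A : Type u} [CStarAlgebra A] {g : Z2Grading A}

theorem toFun_injective : Function.Injective (toFun : EvenState g → A →ₗ[ℂ] ℂ) := by
  rintro ⟨_, _⟩ ⟨_, _⟩ rfl
  rfl

theorem isPositiveFunctional (ω : EvenState g) : IsPositiveFunctional ω.toFun := ω.nonneg

theorem norm_map_le (ω : EvenState g) (a : A) : ‖ω.toFun a‖ ≤ ‖a‖ :=
  ω.isPositiveFunctional.norm_map_le_norm ω.map_one a

theorem map_algebraMap_real (ω : EvenState g) (c : ℝ) : ω.toFun (algebraMap ℝ A c) = c := by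
  rw [Algebra.algebraMap_eq_smul_one, ← Complex.coe_smul, map_smul, ω.map_one, smul_eq_mul,
    mul_one]

theorem re_map_star (ω : EvenState g) (a : A) : (ω.toFun (star a)).re = (ω.toFun a).re := by
  rw [ω.isPositiveFunctional.map_star, Complex.star_def, Complex.conj_re]

theorem map_eq_zero_of_mem (ω : EvenState g) {a : A} (ha : a ∈ g.component 1) :
    ω.toFun a = 0 := by
  have h := ω.even a
  rw [g.mem_component.mp ha, if_neg one_ne_zero, map_neg] at h
  exact self_eq_neg.mp h.symm

/-- The state `ω ∘ j` for a unital `*`-homomorphism `j`. -/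
def comap {B : Type v} [CStarAlgebra B] (ω : EvenState g) (j : B →⋆ₐ[ℂ] A) : State B where
  toFun := ω.toFun ∘ₗ (j : B →ₗ[ℂ] A)
  nonneg b := by
    rw [LinearMap.comp_apply, LinearMap.coe_coe, map_mul, map_star]
    exact ω.nonneg (j b)
  map_one := by simp [ω.map_one]
  even _ := rfl

end EvenState

namespace State

variable {A : Type u} [CStarAlgebra A]

/-- The state given by a contractive unital functional. -/
def ofContractive (Ω : A →ₗ[ℂ] ℂ) (hΩ : ∀ x, ‖Ω x‖ ≤ ‖x‖) (h1 : Ω 1 = 1) : State A where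
  toFun := Ω
  nonneg := isPositiveFunctional_of_contractive hΩ h1
  map_one := h1
  even _ := rfl

/-- The average `(ψ + ψ ∘ θ) / 2`, which turns a state into an even state. -/
def average (g : Z2Grading A) (ψ : State A) : EvenState g where
  toFun := (2⁻¹ : ℂ) • (ψ.toFun + ψ.toFun ∘ₗ g.thetaLin)
  nonneg a := by
    have hθ : 0 ≤ ψ.toFun (g.theta (star a * a)) := by
      simpa only [map_mul, map_star] using ψ.nonneg (g.theta a)
    exact mul_nonneg (inv_nonneg.mpr zero_le_two) (add_nonneg (ψ.nonneg a) hθ)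
  map_one := by
    simp only [Z2Grading.thetaLin, LinearMap.smul_apply, LinearMap.add_apply,
      LinearMap.comp_apply, LinearMap.coe_mk, AddHom.coe_mk, map_one, EvenState.map_one,
      smul_eq_mul]
    norm_num
  even a := by
    simp [Z2Grading.thetaLin, g.involutive, add_comm]

theorem average_apply (g : Z2Grading A) (ψ : State A) (a : A) :
    (ψ.average g).toFun a = 2⁻¹ * (ψ.toFun a + ψ.toFun (g.theta a)) :=
  rfl

theorem one_add_norm_le_norm_one_add [Nontrivial A] [PartialOrder A] [StarOrderedRing A] {p : A}
    (hp : 0 ≤ p) : 1 + ‖p‖ ≤ ‖1 + p‖ := by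
  have hle : (1 : A) ≤ 1 + p := le_add_of_nonneg_right hp
  have h1 : 1 ≤ ‖1 + p‖ := by
    simpa using CStarAlgebra.norm_le_norm_of_nonneg_of_le zero_le_one hle
  have h2 : 1 + p ≤ algebraMap ℝ A ‖1 + p‖ :=
    (CStarAlgebra.norm_le_iff_le_algebraMap _ (norm_nonneg _) (zero_le_one.trans hle)).mp le_rfl
  have h3 : ‖p‖ ≤ ‖1 + p‖ - 1 := by
    rw [CStarAlgebra.norm_le_iff_le_algebraMap _ (sub_nonneg.mpr h1) hp, map_sub, map_one,
      le_sub_iff_add_le']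
    exact h2
  linarith

/-- A norming functional of `1 + a* a` also norms `1` and `a* a`. -/
theorem exists_map_star_mul_self_ne_zero {a : A} (ha : a ≠ 0) :
    ∃ ψ : State A, ψ.toFun (star a * a) ≠ 0 := by
  have : Nontrivial A := ⟨a, 0, ha⟩
  let _ := CStarAlgebra.spectralOrder A
  have _ := CStarAlgebra.spectralOrderedRing A
  obtain ⟨f, hf, hfa⟩ := exists_dual_vector'' ℂ (1 + star a * a)
  have hle (x : A) : ‖f x‖ ≤ ‖x‖ := by simpa using f.le_of_opNorm_le hf x
  have hsum : (f 1).re + (f (star a * a)).re = ‖1 + star a * a‖ := by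
    rw [← Complex.add_re, ← map_add, hfa]
    rfl
  have hnorm := one_add_norm_le_norm_one_add (star_mul_self_nonneg a)
  have hre1 : (f 1).re ≤ ‖f 1‖ := Complex.re_le_norm _
  have hle1 : ‖f 1‖ ≤ 1 := CStarRing.norm_one (E := A) ▸ hle 1
  have hrea : (f (star a * a)).re ≤ ‖star a * a‖ := (Complex.re_le_norm _).trans (hle _)
  have hpos : 0 < ‖star a * a‖ := by simpa using ha
  have hf1 : f 1 = 1 := by
    have hnn : 0 ≤ f 1 := Complex.re_eq_norm.mp (by linarith)
    rw [Complex.eq_re_of_ofReal_le hnn, show (f 1).re = 1 by linarith, Complex.ofReal_one]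
  refine ⟨ofContractive f.toLinearMap hle hf1, fun h0 => ?_⟩
  have hre0 : (f (star a * a)).re = 0 := by
    rw [show f (star a * a) = 0 from h0, Complex.zero_re]
  linarith

end State

theorem EvenState.exists_map_star_mul_self_ne_zero {A : Type u} [CStarAlgebra A] (g : Z2Grading A)
    {a : A} (ha : a ≠ 0) : ∃ ω : EvenState g, ω.toFun (star a * a) ≠ 0 := by
  obtain ⟨ψ, hψ⟩ := State.exists_map_star_mul_self_ne_zero ha
  refine ⟨ψ.average g, fun h0 => hψ ?_⟩
  have hθ : 0 ≤ ψ.toFun (g.theta (star a * a)) := by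
    simpa only [map_mul, map_star] using ψ.nonneg (g.theta a)
  rw [State.average_apply, mul_eq_zero, or_iff_right (by norm_num)] at h0
  exact ((add_eq_zero_iff_of_nonneg (ψ.nonneg a) hθ).mp h0).1

/-! ### Joint extension of states on commuting subalgebras -/

theorem exists_continuousLinearMap_comp_eq {V E : Type*} [AddCommGroup V] [Module ℂ V]
    [NormedAddCommGroup E] [NormedSpace ℂ E] {L : V →ₗ[ℂ] E} {f : V →ₗ[ℂ] ℂ}
    (h : ∀ v, ‖f v‖ ≤ ‖L v‖) :
    ∃ Ω : E →L[ℂ] ℂ, (∀ v, Ω (L v) = f v) ∧ ∀ x, ‖Ω x‖ ≤ ‖x‖ := by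
  have hdense : DenseRange L.rangeRestrict := L.surjective_rangeRestrict.denseRange
  have hbound (v : V) : ‖f v‖ ≤ 1 * ‖L.rangeRestrict v‖ := by simpa using h v
  obtain ⟨Ω, hΩ, hnorm⟩ :=
    exists_extension_norm_eq (LinearMap.range L) (f.extendOfNorm L.rangeRestrict)
  refine ⟨Ω, fun v => ?_, fun x => ?_⟩
  · exact (hΩ (L.rangeRestrict v)).trans (LinearMap.extendOfNorm_eq hdense ⟨1, hbound⟩ v)
  · have hle := LinearMap.opNorm_extendOfNorm_le hdense zero_le_one hbound
    simpa using Ω.le_of_opNorm_le (hnorm.trans_le hle) x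

theorem exists_nonneg_smul_le_mul {A : Type*} [CStarAlgebra A] [PartialOrder A] [StarOrderedRing A]
    {h : A} (hh : 0 ≤ h) {r : ℝ} (hr0 : 0 ≤ r) (hr : r < ‖h‖) :
    ∃ x : A, 0 ≤ x ∧ x ≠ 0 ∧ r • x ≤ h * x := by
  have hsa : IsSelfAdjoint (h - algebraMap ℝ A r) :=
    hh.isSelfAdjoint.sub (IsSelfAdjoint.algebraMap A (.all r))
  set x := (h - algebraMap ℝ A r)⁺ with hx
  have hx0 : 0 ≤ x := CFC.posPart_nonneg _
  have hmul : (h - algebraMap ℝ A r) * x = x * x := by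
    nth_rw 1 [← CFC.posPart_sub_negPart _ hsa]
    rw [sub_mul, hx, CFC.negPart_mul_posPart, sub_zero]
  refine ⟨x, hx0, fun h0 => ?_, ?_⟩
  · have hle : h ≤ algebraMap ℝ A r := sub_nonpos.mp ((CFC.posPart_eq_zero_iff _ hsa).mp h0)
    exact hr.not_ge ((CStarAlgebra.norm_le_iff_le_algebraMap h hr0 hh).mpr hle)
  · rw [sub_mul, Algebra.algebraMap_eq_smul_one, smul_mul_assoc, one_mul] at hmul
    rw [← sub_nonneg, hmul]
    exact Commute.mul_nonneg hx0 hx0 rfl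

/-- Two `*`-homomorphisms with commuting ranges that satisfy the Schlieder property
`i a * j b ≠ 0` for `a, b ≠ 0`: the condition under which two states always have a joint
extension. -/
structure SchliederPair {A B C : Type*} [CStarAlgebra A] [CStarAlgebra B] [CStarAlgebra C]
    (i : A →⋆ₐ[ℂ] C) (j : B →⋆ₐ[ℂ] C) : Prop where
  commute : ∀ a b, Commute (i a) (j b)
  mul_ne_zero : ∀ {a b}, a ≠ 0 → b ≠ 0 → i a * j b ≠ 0

namespace SchliederPair

variable {A B C : Type*} [CStarAlgebra A] [CStarAlgebra B] [CStarAlgebra C]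
  {i : A →⋆ₐ[ℂ] C} {j : B →⋆ₐ[ℂ] C}

theorem add_le_norm_add (hij : SchliederPair i j) [PartialOrder A] [StarOrderedRing A]
    [PartialOrder B] [StarOrderedRing B] {h : A} {k : B} (hh : 0 ≤ h) (hk : 0 ≤ k) {r s : ℝ}
    (hr0 : 0 ≤ r) (hs0 : 0 ≤ s) (hr : r < ‖h‖) (hs : s < ‖k‖) : r + s ≤ ‖i h + j k‖ := by
  let _ := CStarAlgebra.spectralOrder C
  have _ := CStarAlgebra.spectralOrderedRing C
  obtain ⟨x, hx, hx0, hrx⟩ := exists_nonneg_smul_le_mul hh hr0 hr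
  obtain ⟨y, hy, hy0, hsy⟩ := exists_nonneg_smul_le_mul hk hs0 hs
  have mul_nonneg {a : A} {b : B} (ha : 0 ≤ a) (hb : 0 ≤ b) : 0 ≤ i a * j b :=
    Commute.mul_nonneg (map_nonneg i ha) (map_nonneg j hb) (hij.commute a b)
  have hle : (r + s) • (i x * j y) ≤ (i h + j k) * (i x * j y) := by
    have hsum := add_nonneg (mul_nonneg (sub_nonneg.mpr hrx) hy)
      (mul_nonneg hx (sub_nonneg.mpr hsy))
    rw [← sub_nonneg]
    convert hsum using 1
    simp only [map_sub, map_mul, ← Complex.coe_smul, map_smul, sub_mul, mul_sub, add_mul,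
      smul_mul_assoc, mul_smul_comm, add_smul]
    rw [mul_assoc, ← mul_assoc (j k), ← (hij.commute x k).eq, mul_assoc]
    abel
  have hnorm := CStarAlgebra.norm_le_norm_of_nonneg_of_le
    (smul_nonneg (add_nonneg hr0 hs0) (mul_nonneg hx hy)) hle
  rw [norm_smul, Real.norm_of_nonneg (add_nonneg hr0 hs0)] at hnorm
  exact le_of_mul_le_mul_right (hnorm.trans (norm_mul_le _ _))
    (norm_pos_iff.mpr (hij.mul_ne_zero hx0 hy0))

end SchliederPair

theorem nonneg_add_algebraMap_of_norm_le {A : Type*} [CStarAlgebra A] [PartialOrder A]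
    [StarOrderedRing A] {h : A} (hh : IsSelfAdjoint h) {c : ℝ} (hc : ‖h‖ ≤ c) :
    0 ≤ h + algebraMap ℝ A c :=
  (neg_le_iff_add_nonneg.mp hh.neg_algebraMap_norm_le_self).trans
    (add_le_add le_rfl (algebraMap_mono A hc))

namespace EvenState

theorem abs_re_map_le {A : Type u} [CStarAlgebra A] {g : Z2Grading A} (ω : EvenState g) (a : A) :
    |(ω.toFun a).re| ≤ ‖a‖ :=
  (Complex.abs_re_le_norm _).trans (ω.norm_map_le a)

theorem re_map_add_le_norm_add_algebraMap {A : Type u} [CStarAlgebra A] {g : Z2Grading A}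
    (ω : EvenState g) (a : A) (c : ℝ) : (ω.toFun a).re + c ≤ ‖a + algebraMap ℝ A c‖ := by
  simpa only [map_add, ω.map_algebraMap_real, Complex.add_re, Complex.ofReal_re] using
    (abs_le.mp (ω.abs_re_map_le (a + algebraMap ℝ A c))).2

end EvenState

namespace SchliederPair

variable {A : Type u} {B : Type v} {C : Type*} [CStarAlgebra A] [CStarAlgebra B] [CStarAlgebra C]
  {i : A →⋆ₐ[ℂ] C} {j : B →⋆ₐ[ℂ] C}

theorem re_map_add_re_map_le_norm_of_isSelfAdjoint (hij : SchliederPair i j) (ψ : State A)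
    (ω : State B) {h : A} {k : B} (hh : IsSelfAdjoint h) (hk : IsSelfAdjoint k) :
    (ψ.toFun h).re + (ω.toFun k).re ≤ ‖i h + j k‖ := by
  let _ := CStarAlgebra.spectralOrder A
  have _ := CStarAlgebra.spectralOrderedRing A
  let _ := CStarAlgebra.spectralOrder B
  have _ := CStarAlgebra.spectralOrderedRing B
  refine le_of_forall_pos_le_add fun ε hε => ?_
  obtain ⟨c, hc⟩ : ∃ c : ℝ, c = ‖h‖ + ‖k‖ + ε := ⟨_, rfl⟩
  have hc0 : 0 ≤ c := by rw [hc]; positivity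
  have hψ := abs_le.mp (ψ.abs_re_map_le h)
  have hω := abs_le.mp (ω.abs_re_map_le k)
  have hshift := hij.add_le_norm_add
    (nonneg_add_algebraMap_of_norm_le hh (c := c) (by linarith [norm_nonneg k]))
    (nonneg_add_algebraMap_of_norm_le hk (c := c) (by linarith [norm_nonneg h]))
    (r := (ψ.toFun h).re + c - ε / 2) (s := (ω.toFun k).re + c - ε / 2)
    (by linarith [norm_nonneg k]) (by linarith [norm_nonneg h])
    (by linarith [ψ.re_map_add_le_norm_add_algebraMap h c])
    (by linarith [ω.re_map_add_le_norm_add_algebraMap k c])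
  have hsum : i (h + algebraMap ℝ A c) + j (k + algebraMap ℝ B c) =
      (i h + j k) + ((2 * c : ℝ) : ℂ) • (1 : C) := by
    simp only [map_add, Algebra.algebraMap_eq_smul_one, ← Complex.coe_smul, map_smul, map_one]
    push_cast
    module
  have hle : ‖(i h + j k) + ((2 * c : ℝ) : ℂ) • (1 : C)‖ ≤ ‖i h + j k‖ + 2 * c * ‖(1 : C)‖ := by
    refine norm_add_le_of_le le_rfl ?_
    rw [norm_smul, Complex.norm_real, Real.norm_of_nonneg (by positivity)]
  rw [hsum] at hshift
  nlinarith [norm_one_le_one (C := C)]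

theorem re_map_add_re_map_le_norm (hij : SchliederPair i j) (ψ : State A) (ω : State B) (a : A)
    (b : B) : (ψ.toFun a).re + (ω.toFun b).re ≤ ‖i a + j b‖ := by
  have hsa := hij.re_map_add_re_map_le_norm_of_isSelfAdjoint ψ ω (h := a + star a)
    (k := b + star b) (.add_star_self a) (.add_star_self b)
  have hsum : i (a + star a) + j (b + star b) = (i a + j b) + star (i a + j b) := by
    simp only [map_add, map_star, star_add]
    abel
  have hle := norm_add_le (i a + j b) (star (i a + j b))
  rw [norm_star] at hle
  rw [hsum, map_add, map_add, Complex.add_re, Complex.add_re, ψ.re_map_star, ω.re_map_star] at hsa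
  linarith

theorem norm_map_add_map_le_norm (hij : SchliederPair i j) (ψ : State A) (ω : State B) (a : A)
    (b : B) : ‖ψ.toFun a + ω.toFun b‖ ≤ ‖i a + j b‖ := by
  obtain ⟨u, hu, hphase⟩ := Complex.exists_norm_eq_mul_self (ψ.toFun a + ω.toFun b)
  have hre := hij.re_map_add_re_map_le_norm ψ ω (u • a) (u • b)
  rw [map_smul, map_smul, ← Complex.add_re, ← smul_add, smul_eq_mul, ← hphase, map_smul, map_smul,
    ← smul_add, norm_smul, hu, one_mul] at hre
  exact_mod_cast hre

theorem exists_joint_extension (hij : SchliederPair i j) (ψ : State A) (ω : State B) :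
    ∃ Ω : State C, (∀ a, Ω.toFun (i a) = ψ.toFun a) ∧ ∀ b, Ω.toFun (j b) = ω.toFun b := by
  let L : A × B →ₗ[ℂ] C := LinearMap.coprod (i : A →ₗ[ℂ] C) (j : B →ₗ[ℂ] C)
  obtain ⟨Ω, hΩ, hle⟩ := exists_continuousLinearMap_comp_eq (L := L)
    (f := LinearMap.coprod ψ.toFun ω.toFun) fun p => hij.norm_map_add_map_le_norm ψ ω p.1 p.2
  have hi (a : A) : Ω (i a) = ψ.toFun a := by simpa [L] using hΩ (a, 0)
  have hj (b : B) : Ω (j b) = ω.toFun b := by simpa [L] using hΩ (0, b)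
  exact ⟨.ofContractive Ω.toLinearMap hle (by simpa [ψ.map_one] using hi 1), hi, hj⟩

end SchliederPair

/-! ### Extreme even states -/

section ExtremeEvenState

variable {A : Type u} [CStarAlgebra A] {g : Z2Grading A}

variable (g) in
/-- The even states as a set of functions, which puts the topology of pointwise convergence (the
weak-* topology) on them. -/
def evenStateSet : Set (A → ℂ) := Set.range fun ω : EvenState g => ⇑ω.toFun

theorem mem_evenStateSet_iff {f : A → ℂ} :
    f ∈ evenStateSet g ↔ (∀ a b, f (a + b) = f a + f b) ∧ (∀ (c : ℂ) a, f (c • a) = c * f a) ∧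
      (∀ a, 0 ≤ f (star a * a)) ∧ f 1 = 1 ∧ ∀ a, f (g.theta a) = f a := by
  constructor
  · rintro ⟨ω, rfl⟩
    exact ⟨map_add ω.toFun, map_smul ω.toFun, ω.nonneg, ω.map_one, ω.even⟩
  · rintro ⟨hadd, hsmul, hnonneg, hone, heven⟩
    exact ⟨⟨⟨⟨f, hadd⟩, hsmul⟩, hnonneg, hone, heven⟩, rfl⟩

theorem isClosed_evenStateSet : IsClosed (evenStateSet g) := by
  have hset : evenStateSet g =
      (⋂ a, ⋂ b, {f : A → ℂ | f (a + b) = f a + f b}) ∩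
      ((⋂ c : ℂ, ⋂ a, {f : A → ℂ | f (c • a) = c * f a}) ∩
      ((⋂ a, {f : A → ℂ | 0 ≤ f (star a * a)}) ∩ ({f : A → ℂ | f 1 = 1} ∩
      ⋂ a, {f : A → ℂ | f (g.theta a) = f a}))) := by
    ext f
    simp [mem_evenStateSet_iff]
  rw [hset]
  refine .inter (isClosed_iInter fun a => isClosed_iInter fun b => ?_) <|
    .inter (isClosed_iInter fun c => isClosed_iInter fun a => ?_) <|
    .inter (isClosed_iInter fun a => ?_) <| .inter ?_ (isClosed_iInter fun a => ?_)
  · exact isClosed_eq (by fun_prop) (by fun_prop)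
  · exact isClosed_eq (by fun_prop) (by fun_prop)
  · exact isClosed_le (by fun_prop) (by fun_prop)
  · exact isClosed_eq (by fun_prop) (by fun_prop)
  · exact isClosed_eq (by fun_prop) (by fun_prop)

theorem isCompact_evenStateSet : IsCompact (evenStateSet g) := by
  refine (isCompact_univ_pi fun a : A => isCompact_closedBall (0 : ℂ) ‖a‖).of_isClosed_subset
    isClosed_evenStateSet ?_
  rintro _ ⟨ω, rfl⟩ a -
  exact mem_closedBall_zero_iff.mpr (ω.norm_map_le a)

theorem convex_evenStateSet : Convex ℝ (evenStateSet g) := by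
  rintro _ ⟨ω, rfl⟩ _ ⟨ω', rfl⟩ s t hs ht hst
  rw [mem_evenStateSet_iff]
  simp only [Pi.add_apply, Pi.smul_apply]
  refine ⟨fun a b => ?_, fun c a => ?_, fun a => ?_, ?_, fun a => ?_⟩
  · rw [map_add, map_add]
    module
  · simp only [map_smul, Complex.real_smul, smul_eq_mul]
    ring
  · exact add_nonneg (smul_nonneg hs (ω.nonneg a)) (smul_nonneg ht (ω'.nonneg a))
  · rw [ω.map_one, ω'.map_one, ← add_smul, hst, one_smul]
  · rw [ω.even, ω'.even]

namespace EvenState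

/-- Extreme points of the set of even states. For the trivial grading these are the pure states. -/
def IsExtreme (ω : EvenState g) : Prop := ⇑ω.toFun ∈ (evenStateSet g).extremePoints ℝ

theorem IsExtreme.eq_of_add_eq {ω ω₁ ω₂ : EvenState g} (hω : ω.IsExtreme)
    (h : ∀ a, ω₁.toFun a + ω₂.toFun a = 2 * ω.toFun a) : ω₁ = ω := by
  refine toFun_injective (DFunLike.coe_injective
    ((mem_extremePoints_iff_left.mp hω).2 _ ⟨ω₁, rfl⟩ _ ⟨ω₂, rfl⟩ ?_))
  refine ⟨1 / 2, 1 / 2, by norm_num, by norm_num, by norm_num, ?_⟩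
  ext a
  simp only [Pi.add_apply, Pi.smul_apply, Complex.real_smul]
  push_cast
  linear_combination h a / 2

theorem mem_of_forall_isExtreme_mem {S : Set (A → ℂ)} (hclosed : IsClosed S) (hconvex : Convex ℝ S)
    (h : ∀ ω : EvenState g, ω.IsExtreme → ⇑ω.toFun ∈ S) (ω : EvenState g) : ⇑ω.toFun ∈ S := by
  have hsub : evenStateSet g ⊆ S := by
    rw [← closure_convexHull_extremePoints isCompact_evenStateSet convex_evenStateSet]
    refine closure_minimal (convexHull_min (fun f hf => ?_) hconvex) hclosed
    obtain ⟨ω', rfl⟩ := extremePoints_subset hf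
    exact h ω' hf
  exact hsub ⟨ω, rfl⟩

theorem average_comap_id (ω : EvenState g) : (ω.comap (.id ℂ A)).average g = ω := by
  refine toFun_injective (LinearMap.ext fun a => ?_)
  rw [State.average_apply]
  change 2⁻¹ * (ω.toFun a + ω.toFun (g.theta a)) = _
  rw [ω.even]
  ring

/-- Averaging over the grading is a continuous affine map of the states onto the even states, and
extreme points of the image of a compact set lift to extreme points. -/
theorem IsExtreme.exists_pure_average_eq {ω : EvenState g} (hω : ω.IsExtreme) :
    ∃ ψ : State A, ψ.IsExtreme ∧ ψ.average g = ω := by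
  let averaging : (A → ℂ) →L[ℝ] (A → ℂ) :=
    (2⁻¹ : ℂ) • (.id ℝ (A → ℂ) + .pi fun a => .proj (g.theta a))
  have haveraging (ψ : State A) : averaging ψ.toFun = (ψ.average g).toFun := rfl
  have himage : averaging '' evenStateSet (Z2Grading.trivial A) = evenStateSet g := by
    apply Set.Subset.antisymm
    · rintro _ ⟨_, ⟨ψ, rfl⟩, rfl⟩
      exact ⟨State.average g ψ, rfl⟩
    · rintro _ ⟨ω', rfl⟩
      exact ⟨_, ⟨ω'.comap (.id ℂ A), rfl⟩, by rw [haveraging, average_comap_id]⟩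
  have hlift := surjOn_extremePoints_image averaging.toContinuousAffineMap
    (isCompact_evenStateSet (g := Z2Grading.trivial A))
  rw [ContinuousLinearMap.coe_toContinuousAffineMap, himage] at hlift
  obtain ⟨f, hf, hfω⟩ := hlift hω
  obtain ⟨ψ, rfl⟩ := extremePoints_subset hf
  exact ⟨ψ, hf, toFun_injective (DFunLike.coe_injective hfω)⟩

end EvenState

end ExtremeEvenState

section GNSBounded

/-- The functionals `F` with `|F(a* c)| ≤ C ‖a‖_φ ‖c‖_χ`, that is, those for which `F(a* c)` is a
bounded sesquilinear form on the GNS spaces of `φ` and `χ`. -/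
def gnsBounded {B : Type*} [Ring B] [StarRing B] [Algebra ℂ B] (φ χ : B →ₗ[ℂ] ℂ) :
    Submodule ℂ (B →ₗ[ℂ] ℂ) where
  carrier := {F | ∃ C, ∀ a c, ‖F (star a * c)‖ ≤ C * (gnsNorm φ a * gnsNorm χ c)}
  zero_mem' := ⟨0, fun a c => by simp⟩
  add_mem' := by
    rintro F G ⟨C, hC⟩ ⟨D, hD⟩
    refine ⟨C + D, fun a c => (norm_add_le _ _).trans ?_⟩
    rw [add_mul]
    exact add_le_add (hC a c) (hD a c)
  smul_mem' := by
    rintro z F ⟨C, hC⟩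
    refine ⟨‖z‖ * C, fun a c => ?_⟩
    rw [LinearMap.smul_apply, norm_smul, mul_assoc]
    exact mul_le_mul_of_nonneg_left (hC a c) (norm_nonneg z)

variable {B : Type*} [Ring B] [StarRing B] [Algebra ℂ B] {φ χ φ' χ' : B →ₗ[ℂ] ℂ}

theorem gnsBounded_mono {K L : ℝ} (hφ : ∀ a, gnsNorm φ a ≤ K * gnsNorm φ' a)
    (hχ : ∀ a, gnsNorm χ a ≤ L * gnsNorm χ' a) : gnsBounded φ χ ≤ gnsBounded φ' χ' := by
  rintro F ⟨C, hC⟩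
  refine ⟨|C| * (K * L), fun a c => ?_⟩
  have hmul : gnsNorm φ a * gnsNorm χ c ≤ (K * gnsNorm φ' a) * (L * gnsNorm χ' c) :=
    mul_le_mul (hφ a) (hχ c) (gnsNorm_nonneg χ c) ((gnsNorm_nonneg φ a).trans (hφ a))
  calc ‖F (star a * c)‖ ≤ C * (gnsNorm φ a * gnsNorm χ c) := hC a c
    _ ≤ |C| * (gnsNorm φ a * gnsNorm χ c) := by
      gcongr
      · exact mul_nonneg (gnsNorm_nonneg φ a) (gnsNorm_nonneg χ c)
      · exact le_abs_self C
    _ ≤ |C| * ((K * gnsNorm φ' a) * (L * gnsNorm χ' c)) := by gcongr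
    _ = |C| * (K * L) * (gnsNorm φ' a * gnsNorm χ' c) := by ring

theorem IsPositiveFunctional.mem_gnsBounded [StarModule ℂ B] (hφ : IsPositiveFunctional φ) :
    φ ∈ gnsBounded φ φ :=
  ⟨1, fun a c => by simpa using hφ.norm_map_star_mul_le a c⟩

end GNSBounded

namespace EvenState

variable {A : Type u} [CStarAlgebra A] {g : Z2Grading A} {ω : EvenState g} {F : A →ₗ[ℂ] ℂ}

theorem gnsNorm_theta (ω : EvenState g) (a : A) :
    gnsNorm ω.toFun (g.theta a) = gnsNorm ω.toFun a := by
  rw [gnsNorm, ← map_star, ← map_mul, ω.even, gnsNorm]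

theorem comp_thetaLin_mem_gnsBounded (hF : F ∈ gnsBounded ω.toFun ω.toFun) :
    F ∘ₗ g.thetaLin ∈ gnsBounded ω.toFun ω.toFun := by
  obtain ⟨C, hC⟩ := hF
  refine ⟨C, fun a c => ?_⟩
  have h := hC (g.theta a) (g.theta c)
  rwa [← map_star, ← map_mul, ω.gnsNorm_theta, ω.gnsNorm_theta] at h

/-- The perturbation `ω + H` of an even state by a hermitian functional dominated by it. -/
def perturb (ω : EvenState g) (H : A →ₗ[ℂ] ℂ) (hstar : ∀ a, H (star a) = star (H a))
    (heven : ∀ a, H (g.theta a) = H a) (h1 : H 1 = 0)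
    (hle : ∀ a, ‖H (star a * a)‖ ≤ gnsNorm ω.toFun a ^ 2) : EvenState g where
  toFun := ω.toFun + H
  nonneg a := by
    have him : (H (star a * a)).im = 0 := by
      have h := hstar (star a * a)
      rw [star_mul, star_star] at h
      exact Complex.conj_eq_iff_im.mp h.symm
    have hre := (abs_le.mp ((Complex.abs_re_le_norm _).trans (hle a))).1
    rw [LinearMap.add_apply, ω.isPositiveFunctional.map_star_mul_self, Complex.nonneg_iff,
      Complex.add_re, Complex.add_im, Complex.ofReal_re, Complex.ofReal_im, him]
    exact ⟨by linarith, by simp⟩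
  map_one := by rw [LinearMap.add_apply, ω.map_one, h1, add_zero]
  even a := by rw [LinearMap.add_apply, LinearMap.add_apply, ω.even, heven]

theorem IsExtreme.eq_zero_of_norm_le (hω : ω.IsExtreme) {H : A →ₗ[ℂ] ℂ}
    (hstar : ∀ a, H (star a) = star (H a)) (heven : ∀ a, H (g.theta a) = H a) (h1 : H 1 = 0)
    (hle : ∀ a, ‖H (star a * a)‖ ≤ gnsNorm ω.toFun a ^ 2) : H = 0 := by
  have hplus : ω.perturb H hstar heven h1 hle = ω := by
    refine hω.eq_of_add_eq (ω₂ := ω.perturb (-H) (by simp [hstar]) (by simp [heven]) (by simp [h1])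
      (by simpa using hle)) fun a => ?_
    simp only [perturb, LinearMap.add_apply, LinearMap.neg_apply]
    ring
  exact add_eq_left.mp (congrArg toFun hplus)

theorem IsExtreme.eq_smul_of_hermitian (hω : ω.IsExtreme) {H : A →ₗ[ℂ] ℂ}
    (hstar : ∀ a, H (star a) = star (H a)) (heven : ∀ a, H (g.theta a) = H a)
    (hH : H ∈ gnsBounded ω.toFun ω.toFun) : H = H 1 • ω.toFun := by
  obtain ⟨C, hC⟩ : H - H 1 • ω.toFun ∈ gnsBounded ω.toFun ω.toFun :=
    sub_mem hH (Submodule.smul_mem _ _ ω.isPositiveFunctional.mem_gnsBounded)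
  have hc : star (H 1) = H 1 := by rw [← hstar, star_one]
  have ht : 0 < |C| + 1 := by positivity
  have hzero := hω.eq_zero_of_norm_le (H := ((|C| + 1)⁻¹ : ℂ) • (H - H 1 • ω.toFun))
    (fun a => by simp [hstar, ω.isPositiveFunctional.map_star, hc])
    (fun a => by simp [heven, ω.even]) (by simp [ω.map_one]) fun a => ?_
  · rw [smul_eq_zero_iff_right (by exact_mod_cast (inv_pos.mpr ht).ne')] at hzero
    exact sub_eq_zero.mp hzero
  · have hnorm : ‖((|C| + 1)⁻¹ : ℂ)‖ = (|C| + 1)⁻¹ := by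
      rw [← Complex.ofReal_one, ← Complex.ofReal_add, ← Complex.ofReal_inv, Complex.norm_real,
        Real.norm_of_nonneg (inv_nonneg.mpr ht.le)]
    rw [LinearMap.smul_apply, norm_smul, hnorm, inv_mul_le_iff₀ ht, sq]
    refine (hC a a).trans (mul_le_mul_of_nonneg_right ?_ (mul_self_nonneg _))
    linarith [le_abs_self C]

end EvenState

/-- The hermitian part `a ↦ (F(a) + conj F(a*)) / 2` of a functional `F`. -/
def hermitianPart {A : Type*} [CStarAlgebra A] (F : A →ₗ[ℂ] ℂ) : A →ₗ[ℂ] ℂ where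
  toFun a := 2⁻¹ * (F a + star (F (star a)))
  map_add' a b := by
    simp only [map_add, star_add]
    ring
  map_smul' c a := by
    simp only [map_smul, star_smul, smul_eq_mul, star_mul', star_star, RingHom.id_apply]
    ring

section HermitianPart

variable {A : Type u} [CStarAlgebra A] (F : A →ₗ[ℂ] ℂ)

theorem hermitianPart_apply (a : A) : hermitianPart F a = 2⁻¹ * (F a + star (F (star a))) := rfl

theorem hermitianPart_star (a : A) : hermitianPart F (star a) = star (hermitianPart F a) := by
  simp [hermitianPart_apply, add_comm]

theorem hermitianPart_sub_I_smul_hermitianPart :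
    hermitianPart F - Complex.I • hermitianPart (Complex.I • F) = F := by
  ext a
  simp only [hermitianPart_apply, LinearMap.sub_apply, LinearMap.smul_apply, smul_eq_mul,
    star_mul', Complex.star_def, Complex.conj_I]
  linear_combination
    (-2⁻¹ * F a + 2⁻¹ * starRingEnd ℂ (F (star a))) * Complex.I_mul_I

variable {F}

theorem hermitianPart_mem_gnsBounded {φ : A →ₗ[ℂ] ℂ} (hF : F ∈ gnsBounded φ φ) :
    hermitianPart F ∈ gnsBounded φ φ := by
  obtain ⟨C, hC⟩ := hF
  refine ⟨C, fun a c => ?_⟩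
  have hca := hC c a
  rw [mul_comm (gnsNorm φ c)] at hca
  rw [hermitianPart_apply, star_mul, star_star, norm_mul, norm_inv, Complex.norm_ofNat]
  have hsum := norm_add_le_of_le (hC a c) ((norm_star _).trans_le hca)
  linarith

theorem EvenState.IsExtreme.eq_smul {g : Z2Grading A} {ω : EvenState g} (hω : ω.IsExtreme)
    (heven : ∀ a, F (g.theta a) = F a) (hF : F ∈ gnsBounded ω.toFun ω.toFun) :
    F = F 1 • ω.toFun := by
  have hherm {G : A →ₗ[ℂ] ℂ} (hGeven : ∀ a, G (g.theta a) = G a)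
      (hG : G ∈ gnsBounded ω.toFun ω.toFun) :
      hermitianPart G = hermitianPart G 1 • ω.toFun :=
    hω.eq_smul_of_hermitian (hermitianPart_star G)
      (fun a => by
        rw [hermitianPart_apply, ← map_star g.theta, hGeven, hGeven, hermitianPart_apply])
      (hermitianPart_mem_gnsBounded hG)
  obtain ⟨c, hc⟩ : ∃ c : ℂ, F = c • ω.toFun := by
    have hsub := hermitianPart_sub_I_smul_hermitianPart F
    rw [hherm heven hF, hherm (G := Complex.I • F) (by simp [heven]) (Submodule.smul_mem _ _ hF),
      smul_smul, ← sub_smul] at hsub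
    exact ⟨_, hsub.symm⟩
  rw [hc, LinearMap.smul_apply, ω.map_one, smul_eq_mul, mul_one]

end HermitianPart

theorem exists_continuousLinearMap_inner_eq {V H : Type*} [AddCommGroup V] [Module ℂ V]
    [NormedAddCommGroup H] [InnerProductSpace ℂ H] [CompleteSpace H] {e : V →ₗ[ℂ] H}
    (he : DenseRange e) (S : V →ₗ⋆[ℂ] V →ₗ[ℂ] ℂ) {C : ℝ}
    (hS : ∀ x y, ‖S x y‖ ≤ C * (‖e x‖ * ‖e y‖)) :
    ∃ T : H →L[ℂ] H, ∀ x y, inner ℂ (e x) (T (e y)) = S x y := by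
  have hbound (x y : V) : ‖S x y‖ ≤ |C| * ‖e x‖ * ‖e y‖ := by
    rw [mul_assoc]
    exact (hS x y).trans (mul_le_mul_of_nonneg_right (le_abs_self C) (by positivity))
  let rep (x : V) : H := (InnerProductSpace.toDual ℂ H).symm ((S x).extendOfNorm e)
  have hrep (x y : V) : inner ℂ (rep x) (e y) = S x y := by
    rw [InnerProductSpace.toDual_symm_apply, LinearMap.extendOfNorm_eq he ⟨_, hbound x⟩]
  have hnorm (x : V) : ‖rep x‖ ≤ |C| * ‖e x‖ := by
    rw [LinearIsometryEquiv.norm_map]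
    exact LinearMap.opNorm_extendOfNorm_le he (by positivity) (hbound x)
  let repLin : V →ₗ[ℂ] H :=
    { toFun := rep
      map_add' x y := he.eq_of_inner_left ℂ fun z => by simp [inner_add_left, hrep]
      map_smul' c x := he.eq_of_inner_left ℂ fun z => by simp [inner_smul_left, hrep] }
  refine ⟨star (repLin.extendOfNorm e), fun x y => ?_⟩
  rw [ContinuousLinearMap.star_eq_adjoint, ContinuousLinearMap.adjoint_inner_right,
    LinearMap.extendOfNorm_eq he ⟨_, hnorm⟩]
  exact hrep x y

namespace GNSRep

section Commutant

variable {B : Type u} [Ring B] [StarRing B] [Algebra ℂ B] {φ : B →ₗ[ℂ] ℂ} (R : GNSRep φ)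

/-- The commutant `π(B)'` of a GNS representation. -/
def commutant : StarSubalgebra ℂ (R.H →L[ℂ] R.H) :=
  StarSubalgebra.centralizer ℂ (Set.range R.π)

/-- The functional `a ↦ ⟨ξ, T π(a) ξ⟩`. For `T` in the commutant it encodes the operator `T` by a
functional on the algebra. -/
def vectorFunctional (T : R.H →L[ℂ] R.H) : B →ₗ[ℂ] ℂ where
  toFun a := inner ℂ R.ξ (T (R.orbit a))
  map_add' a b := by simp
  map_smul' c a := by simp

variable {R} {T X : R.H →L[ℂ] R.H}

theorem mem_commutant_iff : T ∈ R.commutant ↔ ∀ b, R.π b * T = T * R.π b := by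
  rw [commutant, StarSubalgebra.mem_centralizer_iff]
  refine ⟨fun h b => (h _ ⟨b, rfl⟩).1, ?_⟩
  rintro h _ ⟨b, rfl⟩
  exact ⟨h b, by rw [← map_star, h]⟩

theorem inner_orbit_of_mem_commutant (hT : T ∈ R.commutant) (a c : B) :
    inner ℂ (R.orbit a) (T (R.orbit c)) = R.vectorFunctional T (star a * c) := by
  have hcomm : R.π (star a) (T (R.orbit c)) = T (R.π (star a) (R.orbit c)) :=
    DFunLike.congr_fun (mem_commutant_iff.mp hT (star a)) (R.orbit c)
  calc inner ℂ (R.π a R.ξ) (T (R.orbit c)) = inner ℂ R.ξ (R.π (star a) (T (R.orbit c))) := by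
        rw [inner_π_right, star_star]
    _ = inner ℂ R.ξ (T (R.orbit (star a * c))) := by rw [hcomm, π_orbit]

theorem vectorFunctional_injOn : Set.InjOn R.vectorFunctional R.commutant :=
  fun T hT X hX h => R.continuousLinearMap_ext fun a c => by
    rw [inner_orbit_of_mem_commutant hT, inner_orbit_of_mem_commutant hX, h]

theorem vectorFunctional_mem_gnsBounded (hT : T ∈ R.commutant) :
    R.vectorFunctional T ∈ gnsBounded φ φ := by
  refine ⟨‖T‖, fun a c => ?_⟩
  rw [← inner_orbit_of_mem_commutant hT, ← R.norm_orbit, ← R.norm_orbit]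
  calc ‖inner ℂ (R.orbit a) (T (R.orbit c))‖ ≤ ‖R.orbit a‖ * ‖T (R.orbit c)‖ :=
        norm_inner_le_norm _ _
    _ ≤ ‖R.orbit a‖ * (‖T‖ * ‖R.orbit c‖) := by gcongr; exact T.le_opNorm _
    _ = ‖T‖ * (‖R.orbit a‖ * ‖R.orbit c‖) := by ring

variable (R)

theorem exists_mem_commutant [StarModule ℂ B] {F : B →ₗ[ℂ] ℂ} (hF : F ∈ gnsBounded φ φ) :
    ∃ T ∈ R.commutant, R.vectorFunctional T = F := by
  obtain ⟨C, hC⟩ := hF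
  let form : B →ₗ⋆[ℂ] B →ₗ[ℂ] ℂ := LinearMap.mk₂'ₛₗ (starRingEnd ℂ) (RingHom.id ℂ)
    (fun a c => F (star a * c)) (by simp [add_mul]) (by simp) (by simp [mul_add]) (by simp)
  obtain ⟨T, hT⟩ := exists_continuousLinearMap_inner_eq R.denseRange_orbit form
    (C := C) fun a c => by simpa [form, norm_orbit] using hC a c
  have hT' (a c : B) : inner ℂ (R.orbit a) (T (R.orbit c)) = F (star a * c) := hT a c
  refine ⟨T, mem_commutant_iff.mpr fun b => R.continuousLinearMap_ext fun a c => ?_, ?_⟩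
  · rw [mul_apply_eq_comp, mul_apply_eq_comp, inner_π_right, π_orbit, π_orbit, hT', hT', star_mul,
      star_star, mul_assoc]
  · ext a
    rw [vectorFunctional, LinearMap.coe_mk, AddHom.coe_mk, ← orbit_one, hT', star_one, one_mul]

end Commutant

section GradingUnitary

variable {A : Type u} [CStarAlgebra A] {g : Z2Grading A} {ω : EvenState g} (R : GNSRep ω.toFun)

/-- The operator `π(a) ξ ↦ π(θ a) ξ` on the GNS space of an even state. -/
def gradingOperator : R.H →L[ℂ] R.H := (R.orbit ∘ₗ g.thetaLin).extendOfNorm R.orbit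

theorem gradingOperator_orbit (a : A) : R.gradingOperator (R.orbit a) = R.orbit (g.theta a) :=
  LinearMap.extendOfNorm_eq R.denseRange_orbit ⟨1, fun a => by
    rw [one_mul, R.norm_orbit, ← ω.gnsNorm_theta, ← R.norm_orbit]
    rfl⟩ a

theorem gradingOperator_mul_self : R.gradingOperator * R.gradingOperator = 1 :=
  R.continuousLinearMap_ext fun a c => by
    rw [mul_apply_eq_comp, gradingOperator_orbit, gradingOperator_orbit, g.involutive,
      one_apply_eq_self]

theorem star_gradingOperator : star R.gradingOperator = R.gradingOperator :=
  R.continuousLinearMap_ext fun a c => by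
    rw [ContinuousLinearMap.star_eq_adjoint, ContinuousLinearMap.adjoint_inner_right,
      gradingOperator_orbit, gradingOperator_orbit, inner_orbit, inner_orbit,
      ← ω.even (star a * _), map_mul g.theta, map_star g.theta, g.involutive]

/-- The unitary implementing the grading in the GNS representation of an even state. -/
def gradingUnitary : unitary (R.H →L[ℂ] R.H) :=
  ⟨R.gradingOperator, Unitary.mem_iff.mpr (by
    rw [star_gradingOperator, gradingOperator_mul_self]
    exact ⟨rfl, rfl⟩)⟩

/-- The grading of the operators on the GNS space of an even state: conjugation by the unitary
implementing the grading of the algebra. -/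
def gradingConj : (R.H →L[ℂ] R.H) ≃⋆ₐ[ℂ] (R.H →L[ℂ] R.H) :=
  Unitary.conjStarAlgAut ℂ _ R.gradingUnitary

theorem inner_orbit_gradingConj (T : R.H →L[ℂ] R.H) (a c : A) :
    inner ℂ (R.orbit a) (R.gradingConj T (R.orbit c)) =
      inner ℂ (R.orbit (g.theta a)) (T (R.orbit (g.theta c))) := by
  have hconj : R.gradingConj T = R.gradingOperator * T * star R.gradingOperator := rfl
  rw [hconj, star_gradingOperator, mul_apply_eq_comp, mul_apply_eq_comp, gradingOperator_orbit,
    ← R.gradingOperator_orbit a, ← R.star_gradingOperator, ContinuousLinearMap.star_eq_adjoint,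
    ContinuousLinearMap.adjoint_inner_left, ← ContinuousLinearMap.star_eq_adjoint,
    R.star_gradingOperator]

variable {R} {T X Y : R.H →L[ℂ] R.H}

theorem gradingConj_eq_smul {s : ℂ} (hT : T ∈ R.commutant)
    (h : ∀ a, R.vectorFunctional T (g.theta a) = s * R.vectorFunctional T a) :
    R.gradingConj T = s • T :=
  R.continuousLinearMap_ext fun a c => by
    rw [inner_orbit_gradingConj, inner_orbit_of_mem_commutant hT, ← map_star g.theta, ← map_mul, h,
      smul_apply, inner_smul_right, inner_orbit_of_mem_commutant hT]

theorem vectorFunctional_theta (hT : T ∈ R.commutant) (h : R.gradingConj T = T) (a : A) :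
    R.vectorFunctional T (g.theta a) = R.vectorFunctional T a := by
  have := R.inner_orbit_gradingConj T 1 a
  rw [h, inner_orbit_of_mem_commutant hT, inner_orbit_of_mem_commutant hT, map_one g.theta,
    star_one, one_mul, one_mul] at this
  exact this.symm

theorem eq_smul_one_of_gradingConj_eq (hω : ω.IsExtreme) (hT : T ∈ R.commutant)
    (h : R.gradingConj T = T) : T = R.vectorFunctional T 1 • 1 := by
  refine vectorFunctional_injOn hT (R.commutant.smul_mem R.commutant.one_mem _) ?_
  have hsmul := hω.eq_smul (vectorFunctional_theta hT h) (vectorFunctional_mem_gnsBounded hT)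
  rw [hsmul]
  ext a
  simp [vectorFunctional, orbit, R.inner_eq, ω.map_one]

theorem exists_eq_smul_of_gradingConj_eq_neg (hω : ω.IsExtreme) (hX : X ∈ R.commutant)
    (hY : Y ∈ R.commutant) (hXodd : R.gradingConj X = -X) (hYodd : R.gradingConj Y = -Y)
    (hY0 : Y ≠ 0) : ∃ d : ℂ, X = d • Y := by
  have hYstar : R.gradingConj (star Y) = -star Y := by
    rw [← star_neg, ← hYodd]
    exact R.gradingConj.map_star' Y
  obtain ⟨μ, hμ⟩ : ∃ μ : ℂ, star Y * Y = μ • 1 := ⟨_, eq_smul_one_of_gradingConj_eq hω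
    (mul_mem (star_mem hY) hY) (by rw [map_mul, hYstar, hYodd, neg_mul_neg])⟩
  obtain ⟨ν, hν⟩ : ∃ ν : ℂ, X * star Y = ν • 1 := ⟨_, eq_smul_one_of_gradingConj_eq hω
    (mul_mem hX (star_mem hY)) (by rw [map_mul, hXodd, hYstar, neg_mul_neg])⟩
  have hμ0 : μ ≠ 0 := by
    rintro rfl
    rw [zero_smul, CStarRing.star_mul_self_eq_zero_iff] at hμ
    exact hY0 hμ
  have hXY : μ • X = ν • Y := by
    calc μ • X = X * (star Y * Y) := by rw [hμ, mul_smul_comm, mul_one]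
      _ = ν • Y := by rw [← mul_assoc, hν, smul_mul_assoc, one_mul]
  exact ⟨μ⁻¹ * ν, by rw [mul_smul, ← hXY, inv_smul_smul₀ hμ0]⟩

end GradingUnitary

end GNSRep

namespace EvenState

variable {A : Type u} [CStarAlgebra A] {g : Z2Grading A} {ω : EvenState g} {F G : A →ₗ[ℂ] ℂ}

theorem IsExtreme.exists_eq_smul_of_odd (hω : ω.IsExtreme)
    (hF : F ∈ gnsBounded ω.toFun ω.toFun) (hFodd : ∀ a, F (g.theta a) = -F a)
    (hG : G ∈ gnsBounded ω.toFun ω.toFun) (hGodd : ∀ a, G (g.theta a) = -G a) (hG0 : G ≠ 0) :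
    ∃ d : ℂ, F = d • G := by
  let R := GNSRep.ofCStarAlgebra ω.isPositiveFunctional
  obtain ⟨X, hX, rfl⟩ := R.exists_mem_commutant hF
  obtain ⟨Y, hY, rfl⟩ := R.exists_mem_commutant hG
  have hodd {T : R.H →L[ℂ] R.H} (hT : T ∈ R.commutant)
      (h : ∀ a, R.vectorFunctional T (g.theta a) = -R.vectorFunctional T a) :
      R.gradingConj T = -T := by
    rw [GNSRep.gradingConj_eq_smul (s := -1) hT (by simpa using h), neg_one_smul]
  have hY0 : Y ≠ 0 := by
    rintro rfl
    exact hG0 (by ext a; simp [GNSRep.vectorFunctional])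
  obtain ⟨d, rfl⟩ := GNSRep.exists_eq_smul_of_gradingConj_eq_neg hω hX hY (hodd hX hFodd)
    (hodd hY hGodd) hY0
  exact ⟨d, by ext a; simp [GNSRep.vectorFunctional]⟩

end EvenState

theorem exists_le_mul_of_norm_add_sq_le {α β : ℂ} (hα : α ≠ 0) (C : ℝ) :
    ∃ K : ℝ, ∀ s t : ℝ, 0 ≤ s → 0 ≤ t → ‖α * (s ^ 2 : ℝ) + β * (t ^ 2 : ℝ)‖ ≤ C * (s * t) →
      s ≤ K * t := by
  have hα' : 0 < ‖α‖ := norm_pos_iff.mpr hα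
  refine ⟨1 + (‖β‖ + |C|) / ‖α‖, fun s t hs ht hle => ?_⟩
  have hK : 0 ≤ (‖β‖ + |C|) / ‖α‖ := by positivity
  rcases le_total s t with hst | hts
  · nlinarith [mul_nonneg hK ht]
  have hα_sq : ‖α‖ * s ^ 2 ≤ |C| * (s * t) + ‖β‖ * t ^ 2 := by
    have htri := norm_sub_le (α * (s ^ 2 : ℝ) + β * (t ^ 2 : ℝ)) (β * (t ^ 2 : ℝ))
    rw [add_sub_cancel_right, norm_mul, norm_mul, Complex.norm_real, Complex.norm_real,
      Real.norm_of_nonneg (sq_nonneg s), Real.norm_of_nonneg (sq_nonneg t)] at htri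
    have hC : C * (s * t) ≤ |C| * (s * t) := by gcongr; exact le_abs_self C
    linarith
  rcases hs.eq_or_lt with rfl | hs
  · positivity
  have hdiv : s ≤ (‖β‖ + |C|) / ‖α‖ * t := by
    rw [div_mul_eq_mul_div, le_div_iff₀ hα']
    refine le_of_mul_le_mul_right ?_ hs
    nlinarith [mul_le_mul_of_nonneg_left hts (mul_nonneg (norm_nonneg β) ht)]
  linarith

section PureDecomposition

variable {A : Type u} [CStarAlgebra A] {g : Z2Grading A} {ψ : State A} {F : A →ₗ[ℂ] ℂ}

theorem gnsNorm_comp_thetaLin (φ : A →ₗ[ℂ] ℂ) (a : A) :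
    gnsNorm (φ ∘ₗ g.thetaLin) a = gnsNorm φ (g.theta a) := by
  rw [gnsNorm, gnsNorm, ← map_star g.theta, ← map_mul g.theta]
  rfl

theorem IsPositiveFunctional.comp_thetaLin {φ : A →ₗ[ℂ] ℂ} (hφ : IsPositiveFunctional φ) :
    IsPositiveFunctional (φ ∘ₗ g.thetaLin) := fun a => by
  have h := hφ (g.theta a)
  rwa [← map_star g.theta, ← map_mul g.theta] at h

theorem State.gnsNorm_le_average (ψ : State A) (a : A) :
    gnsNorm ψ.toFun a ≤ 2 * gnsNorm (ψ.average g).toFun a := by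
  have hω := (ψ.average g).isPositiveFunctional.map_star_mul_self a
  rw [State.average_apply, ψ.isPositiveFunctional.map_star_mul_self, map_mul g.theta,
    map_star g.theta, ψ.isPositiveFunctional.map_star_mul_self] at hω
  have hsq : gnsNorm (ψ.average g).toFun a ^ 2 =
      2⁻¹ * (gnsNorm ψ.toFun a ^ 2 + gnsNorm ψ.toFun (g.theta a) ^ 2) := by
    refine Complex.ofReal_injective (hω.symm.trans ?_)
    push_cast
    ring
  nlinarith [gnsNorm_nonneg (ψ.average g).toFun a, gnsNorm_nonneg ψ.toFun a,
    sq_nonneg (gnsNorm ψ.toFun (g.theta a))]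

theorem State.mem_gnsBounded_average (ψ : State A) :
    ψ.toFun ∈ gnsBounded (ψ.average g).toFun (ψ.average g).toFun :=
  gnsBounded_mono ψ.gnsNorm_le_average ψ.gnsNorm_le_average ψ.isPositiveFunctional.mem_gnsBounded

theorem State.gnsBounded_comp_thetaLin_le (ψ : State A) :
    gnsBounded ψ.toFun (ψ.toFun ∘ₗ g.thetaLin) ≤
      gnsBounded (ψ.average g).toFun (ψ.average g).toFun :=
  gnsBounded_mono ψ.gnsNorm_le_average fun a => by
    rw [gnsNorm_comp_thetaLin, ← (ψ.average g).gnsNorm_theta]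
    exact ψ.gnsNorm_le_average _

theorem State.exists_eq_smul_add_smul (hψ : (ψ.average g).IsExtreme)
    (hne : ψ.toFun ∘ₗ g.thetaLin ≠ ψ.toFun)
    (hF : F ∈ gnsBounded (ψ.average g).toFun (ψ.average g).toFun) :
    ∃ α β : ℂ, F = α • ψ.toFun + β • ψ.toFun ∘ₗ g.thetaLin := by
  have hθθ (G : A →ₗ[ℂ] ℂ) : (G ∘ₗ g.thetaLin) ∘ₗ g.thetaLin = G := by
    ext a
    exact congrArg G (g.involutive a)
  obtain ⟨c, hc⟩ : ∃ c : ℂ, F + F ∘ₗ g.thetaLin = c • (ψ.average g).toFun :=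
    ⟨_, hψ.eq_smul (DFunLike.congr_fun (f := (F + F ∘ₗ g.thetaLin) ∘ₗ g.thetaLin) (by
        rw [LinearMap.add_comp, hθθ, add_comm]))
      (add_mem hF (EvenState.comp_thetaLin_mem_gnsBounded hF))⟩
  have hodd (G : A →ₗ[ℂ] ℂ) (a : A) :
      (G - G ∘ₗ g.thetaLin) (g.theta a) = -(G - G ∘ₗ g.thetaLin) a :=
    DFunLike.congr_fun (f := (G - G ∘ₗ g.thetaLin) ∘ₗ g.thetaLin)
      (g := -(G - G ∘ₗ g.thetaLin)) (by rw [LinearMap.sub_comp, hθθ, neg_sub]) a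
  obtain ⟨d, hd⟩ := hψ.exists_eq_smul_of_odd
    (sub_mem hF (EvenState.comp_thetaLin_mem_gnsBounded hF)) (hodd F)
    (sub_mem ψ.mem_gnsBounded_average
      (EvenState.comp_thetaLin_mem_gnsBounded ψ.mem_gnsBounded_average)) (hodd ψ.toFun)
    (sub_ne_zero.mpr hne.symm)
  refine ⟨2⁻¹ * (2⁻¹ * c + d), 2⁻¹ * (2⁻¹ * c - d), ?_⟩
  have haverage : (ψ.average g).toFun = (2⁻¹ : ℂ) • (ψ.toFun + ψ.toFun ∘ₗ g.thetaLin) := rfl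
  rw [haverage] at hc
  have hsum : F = (2⁻¹ : ℂ) • ((F + F ∘ₗ g.thetaLin) + (F - F ∘ₗ g.thetaLin)) := by module
  rw [hsum, hc, hd]
  module

theorem State.comp_thetaLin_eq_of_gnsNorm_le (hψ : ψ.IsExtreme) {K : ℝ}
    (hK : ∀ a, gnsNorm ψ.toFun (g.theta a) ≤ K * gnsNorm ψ.toFun a) :
    ψ.toFun ∘ₗ g.thetaLin = ψ.toFun := by
  have hK' (a : A) : gnsNorm (ψ.toFun ∘ₗ g.thetaLin) a ≤ K * gnsNorm ψ.toFun a := by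
    rw [gnsNorm_comp_thetaLin]
    exact hK a
  have h1 : (ψ.toFun ∘ₗ g.thetaLin) 1 = 1 := by
    rw [← ψ.map_one]
    exact congrArg ψ.toFun (map_one g.theta)
  rw [hψ.eq_smul (fun _ => rfl)
    (gnsBounded_mono hK' hK' ψ.isPositiveFunctional.comp_thetaLin.mem_gnsBounded), h1, one_smul]

theorem State.eq_zero_of_mem_gnsBounded_comp_thetaLin (hψ : ψ.IsExtreme)
    (hω : (ψ.average g).IsExtreme) (hne : ψ.toFun ∘ₗ g.thetaLin ≠ ψ.toFun)
    (hF : F ∈ gnsBounded ψ.toFun (ψ.toFun ∘ₗ g.thetaLin)) : F = 0 := by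
  obtain ⟨α, β, hαβ⟩ := ψ.exists_eq_smul_add_smul hω hne (ψ.gnsBounded_comp_thetaLin_le hF)
  obtain ⟨C, hC⟩ := hF
  have hdiag (a : A) : ‖α * (gnsNorm ψ.toFun a ^ 2 : ℝ) +
      β * (gnsNorm ψ.toFun (g.theta a) ^ 2 : ℝ)‖ ≤
      C * (gnsNorm ψ.toFun a * gnsNorm ψ.toFun (g.theta a)) := by
    have h := hC a a
    rw [hαβ, LinearMap.add_apply, LinearMap.smul_apply, LinearMap.smul_apply,
      ψ.isPositiveFunctional.map_star_mul_self,
      ψ.isPositiveFunctional.comp_thetaLin.map_star_mul_self, gnsNorm_comp_thetaLin] at h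
    exact h
  have hα : α = 0 := by
    by_contra hα
    obtain ⟨K, hK⟩ := exists_le_mul_of_norm_add_sq_le (β := β) hα C
    refine hne (State.comp_thetaLin_eq_of_gnsNorm_le hψ (K := K) fun a => ?_)
    have h := hK _ _ (gnsNorm_nonneg _ _) (gnsNorm_nonneg _ _) (hdiag (g.theta a))
    rwa [g.involutive] at h
  have hβ : β = 0 := by
    by_contra hβ
    obtain ⟨K, hK⟩ := exists_le_mul_of_norm_add_sq_le (β := α) hβ C
    refine hne (State.comp_thetaLin_eq_of_gnsNorm_le hψ (K := K) fun a =>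
      hK _ _ (gnsNorm_nonneg _ _) (gnsNorm_nonneg _ _) ?_)
    rw [add_comm, mul_comm (gnsNorm ψ.toFun (g.theta a))]
    exact hdiag a
  rw [hαβ, hα, hβ, zero_smul, zero_smul, add_zero]

theorem State.map_eq_zero_of_mem_gnsBounded_comp_thetaLin (hψ : ψ.IsExtreme)
    (hω : (ψ.average g).IsExtreme) (hF : F ∈ gnsBounded ψ.toFun (ψ.toFun ∘ₗ g.thetaLin)) {a : A}
    (ha : a ∈ g.component 1) : F a = 0 := by
  by_cases hθ : ψ.toFun ∘ₗ g.thetaLin = ψ.toFun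
  · rw [hθ] at hF
    have hψa : ψ.toFun (g.theta a) = ψ.toFun a := DFunLike.congr_fun hθ a
    rw [g.mem_component.mp ha, if_neg one_ne_zero, map_neg] at hψa
    rw [hψ.eq_smul (fun _ => rfl) hF, LinearMap.smul_apply, self_eq_neg.mp hψa.symm, smul_zero]
  · rw [State.eq_zero_of_mem_gnsBounded_comp_thetaLin hψ hω hθ hF, LinearMap.zero_apply]

end PureDecomposition

/-! ### The Fermi product and product states -/

theorem Z2Grading.theta_mem {A : Type*} [CStarAlgebra A] (g : Z2Grading A) {i : ZMod 2} {a : A}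
    (ha : a ∈ g.component i) : g.theta a ∈ g.component i := by
  rw [g.mem_component.mp ha]
  split_ifs
  · exact ha
  · exact neg_mem ha

namespace FermiProduct

variable {A₁ : Type u} {A₂ : Type v} [CStarAlgebra A₁] [CStarAlgebra A₂]

variable (g₁ : Z2Grading A₁) (g₂ : Z2Grading A₂)

/-- The inclusion `a ↦ a ⊗ 1` of the first factor. -/
def inclLeft : A₁ →⋆ₐ[ℂ] FermiProduct g₁ g₂ where
  __ := GradedTensorProduct.includeLeft g₁.component g₂.component
  map_star' a := by
    have hstar (i : ZMod 2) (b : A₁) (hb : b ∈ g₁.component i) :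
        ofTensor g₁ g₂ (star b ⊗ₜ 1) = star (ofTensor g₁ g₂ (b ⊗ₜ 1)) := by
      rw [star_tmul_of_mem hb (SetLike.one_mem_graded g₂.component)]
      simp [koszulSign]
    change ofTensor g₁ g₂ (star a ⊗ₜ 1) = star (ofTensor g₁ g₂ (a ⊗ₜ 1))
    rw [← g₁.proj_zero_add_proj_one a, star_add, TensorProduct.add_tmul, TensorProduct.add_tmul,
      map_add, map_add, star_add, hstar 0 _ (g₁.proj_mem 0 a), hstar 1 _ (g₁.proj_mem 1 a)]

/-- The inclusion `b ↦ 1 ⊗ b` of the second factor. -/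
def inclRight : A₂ →⋆ₐ[ℂ] FermiProduct g₁ g₂ where
  __ := GradedTensorProduct.includeRight g₁.component g₂.component
  map_star' b := by
    have hstar (i : ZMod 2) (c : A₂) (hc : c ∈ g₂.component i) :
        ofTensor g₁ g₂ (1 ⊗ₜ star c) = star (ofTensor g₁ g₂ (1 ⊗ₜ c)) := by
      rw [star_tmul_of_mem (SetLike.one_mem_graded g₁.component) hc]
      simp [koszulSign]
    change ofTensor g₁ g₂ (1 ⊗ₜ star b) = star (ofTensor g₁ g₂ (1 ⊗ₜ b))
    rw [← g₂.proj_zero_add_proj_one b, star_add, TensorProduct.tmul_add, TensorProduct.tmul_add,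
      map_add, map_add, star_add, hstar 0 _ (g₂.proj_mem 0 b), hstar 1 _ (g₂.proj_mem 1 b)]

variable {g₁ g₂}

theorem inclLeft_apply (a : A₁) : inclLeft g₁ g₂ a = ofTensor g₁ g₂ (a ⊗ₜ 1) := rfl

theorem inclRight_apply (b : A₂) : inclRight g₁ g₂ b = ofTensor g₁ g₂ (1 ⊗ₜ b) := rfl

theorem inclLeft_mul_inclRight (a : A₁) (b : A₂) :
    inclLeft g₁ g₂ a * inclRight g₁ g₂ b = ofTensor g₁ g₂ (a ⊗ₜ b) := by
  rw [inclLeft_apply, inclRight_apply, mul_tmul_of_mem a b (SetLike.one_mem_graded g₂.component)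
    (SetLike.one_mem_graded g₁.component)]
  simp [koszulSign]

theorem inclRight_mul_inclLeft_of_mem {i j : ZMod 2} {a : A₁} {b : A₂}
    (ha : a ∈ g₁.component i) (hb : b ∈ g₂.component j) :
    inclRight g₁ g₂ b * inclLeft g₁ g₂ a =
      koszulSign j i • (inclLeft g₁ g₂ a * inclRight g₁ g₂ b) := by
  rw [inclLeft_mul_inclRight, inclLeft_apply, inclRight_apply, mul_tmul_of_mem _ _ hb ha, one_mul,
    mul_one]

theorem commute_inclLeft_inclRight (a : A₁) {b : A₂} (hb : b ∈ g₂.component 0) :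
    Commute (inclLeft g₁ g₂ a) (inclRight g₁ g₂ b) := by
  have hcomm (i : ZMod 2) : Commute (inclLeft g₁ g₂ (g₁.proj i a)) (inclRight g₁ g₂ b) := by
    rw [commute_iff_eq, inclRight_mul_inclLeft_of_mem (g₁.proj_mem i a) hb]
    simp [koszulSign]
  rw [← g₁.proj_zero_add_proj_one a, map_add]
  exact (hcomm 0).add_left (hcomm 1)

theorem inclRight_mul_inclLeft_of_odd (a : A₁) {b : A₂} (hb : b ∈ g₂.component 1) :
    inclRight g₁ g₂ b * inclLeft g₁ g₂ a = inclLeft g₁ g₂ (g₁.theta a) * inclRight g₁ g₂ b := by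
  have hswap (i : ZMod 2) : inclRight g₁ g₂ b * inclLeft g₁ g₂ (g₁.proj i a) =
      inclLeft g₁ g₂ (g₁.theta (g₁.proj i a)) * inclRight g₁ g₂ b := by
    rw [inclRight_mul_inclLeft_of_mem (g₁.proj_mem i a) hb,
      g₁.mem_component.mp (g₁.proj_mem i a)]
    rcases zmod_two_cases i with rfl | rfl <;> simp [koszulSign]
  rw [← g₁.proj_zero_add_proj_one a, map_add, map_add, map_add, mul_add, add_mul, hswap, hswap]

theorem grading_tmul (a : A₁) (b : A₂) :
    grading g₁ g₂ (ofTensor g₁ g₂ (a ⊗ₜ b)) =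
      ofTensor g₁ g₂ (g₁.theta a ⊗ₜ g₂.theta b) := rfl

theorem grading_grading (x : FermiProduct g₁ g₂) : grading g₁ g₂ (grading g₁ g₂ x) = x := by
  induction x using induction_homogeneous with
  | hadd x y hx hy => rw [map_add, map_add, hx, hy]
  | hmul _ _ a b _ _ => rw [grading_tmul, grading_tmul, g₁.involutive, g₂.involutive]

theorem grading_star (x : FermiProduct g₁ g₂) :
    grading g₁ g₂ (star x) = star (grading g₁ g₂ x) := by
  induction x using induction_homogeneous with
  | hadd x y hx hy => rw [map_add, star_add, star_add, map_add, hx, hy]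
  | hmul i j a b ha hb =>
    rw [star_tmul_of_mem ha hb, map_smul, grading_tmul, grading_tmul,
      star_tmul_of_mem (g₁.theta_mem ha) (g₂.theta_mem hb), map_star, map_star]

theorem grading_mul (x y : FermiProduct g₁ g₂) :
    grading g₁ g₂ (x * y) = grading g₁ g₂ x * grading g₁ g₂ y := by
  induction x using induction_homogeneous with
  | hadd x x' hx hx' => rw [add_mul, map_add, map_add, add_mul, hx, hx']
  | hmul _ j a b _ hb =>
    induction y using induction_homogeneous with
    | hadd y y' hy hy' => rw [mul_add, map_add, map_add, mul_add, hy, hy']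
    | hmul k _ c d hc _ =>
      rw [mul_tmul_of_mem a d hb hc, map_smul, grading_tmul, grading_tmul, grading_tmul,
        mul_tmul_of_mem _ _ (g₂.theta_mem hb) (g₁.theta_mem hc), map_mul, map_mul]

variable (g₁ g₂) in
/-- The product grading as a `*`-homomorphism. -/
def gradingHom : FermiProduct g₁ g₂ →⋆ₐ[ℂ] FermiProduct g₁ g₂ where
  __ := AlgHom.ofLinearMap (grading g₁ g₂)
    (by
      change grading g₁ g₂ (ofTensor g₁ g₂ (1 ⊗ₜ 1)) = ofTensor g₁ g₂ (1 ⊗ₜ 1)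
      rw [grading_tmul, map_one, map_one]) grading_mul
  map_star' := grading_star

end FermiProduct

namespace EvenState

open FermiProduct

variable {A₁ : Type u} {A₂ : Type v} [CStarAlgebra A₁] [CStarAlgebra A₂]
  {g₁ : Z2Grading A₁} {g₂ : Z2Grading A₂} (ω₁ : EvenState g₁) (ω₂ : EvenState g₂)

theorem prod_tmul (a : A₁) (b : A₂) :
    ω₁.prod ω₂ (ofTensor g₁ g₂ (a ⊗ₜ b)) = ω₁.toFun a * ω₂.toFun b := rfl

theorem prod_one : ω₁.prod ω₂ 1 = 1 := by
  change ω₁.prod ω₂ (ofTensor g₁ g₂ (1 ⊗ₜ 1)) = 1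
  rw [prod_tmul, ω₁.map_one, ω₂.map_one, one_mul]

theorem prod_grading (x : FermiProduct g₁ g₂) :
    ω₁.prod ω₂ (grading g₁ g₂ x) = ω₁.prod ω₂ x := by
  induction x using induction_homogeneous with
  | hadd x y hx hy => rw [map_add, map_add, map_add, hx, hy]
  | hmul _ _ a b _ _ => rw [grading_tmul, prod_tmul, prod_tmul, ω₁.even, ω₂.even]

/-- For `a`, `c` of equal parity the signs of the involution and of the product cancel; otherwise
both sides vanish because `ω₁` is even. -/
theorem prod_star_tmul_mul_tmul_of_mem {i j k : ZMod 2} {a c : A₁} {b : A₂} (d : A₂)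
    (ha : a ∈ g₁.component i) (hb : b ∈ g₂.component j) (hc : c ∈ g₁.component k) :
    ω₁.prod ω₂ (star (ofTensor g₁ g₂ (a ⊗ₜ b)) * ofTensor g₁ g₂ (c ⊗ₜ d)) =
      ω₁.toFun (star a * c) * ω₂.toFun (star b * d) := by
  rw [star_tmul_of_mem ha hb, smul_mul_assoc, mul_tmul_of_mem _ _ (g₂.star_mem hb) hc, smul_smul,
    map_smul, prod_tmul]
  by_cases hik : i = k
  · subst hik
    rcases zmod_two_cases i with rfl | rfl <;> rcases zmod_two_cases j with rfl | rfl <;>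
      simp [koszulSign]
  · have hadd : i + k = 1 := (by decide : ∀ i k : ZMod 2, i ≠ k → i + k = 1) i k hik
    have hodd := SetLike.mul_mem_graded (g₁.star_mem ha) hc
    rw [hadd] at hodd
    rw [ω₁.map_eq_zero_of_mem hodd, zero_mul, smul_zero]

/-- The map `a ⊗ b ↦ π₁(a) ξ₁ ⊗ π₂(b) ξ₂` into the tensor product of the GNS spaces, which realizes
the GNS inner product of `ω₁ × ω₂`. -/
def tensorOrbit (R₁ : GNSRep ω₁.toFun) (R₂ : GNSRep ω₂.toFun) :
    FermiProduct g₁ g₂ →ₗ[ℂ] R₁.H ⊗[ℂ] R₂.H :=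
  TensorProduct.map R₁.orbit R₂.orbit ∘ₗ (ofTensor g₁ g₂).symm.toLinearMap

theorem tensorOrbit_tmul (R₁ : GNSRep ω₁.toFun) (R₂ : GNSRep ω₂.toFun) (a : A₁) (b : A₂) :
    tensorOrbit ω₁ ω₂ R₁ R₂ (ofTensor g₁ g₂ (a ⊗ₜ b)) = R₁.orbit a ⊗ₜ R₂.orbit b := rfl

theorem inner_tensorOrbit (R₁ : GNSRep ω₁.toFun) (R₂ : GNSRep ω₂.toFun)
    (x y : FermiProduct g₁ g₂) :
    inner ℂ (tensorOrbit ω₁ ω₂ R₁ R₂ x) (tensorOrbit ω₁ ω₂ R₁ R₂ y) =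
      ω₁.prod ω₂ (star x * y) := by
  induction x using induction_homogeneous with
  | hadd x x' hx hx' => rw [map_add, star_add, add_mul, map_add, inner_add_left, hx, hx']
  | hmul i j a b ha hb =>
    induction y using induction_homogeneous with
    | hadd y y' hy hy' => rw [map_add, mul_add, map_add, inner_add_right, hy, hy']
    | hmul k _ c d hc _ =>
      rw [tensorOrbit_tmul, tensorOrbit_tmul, TensorProduct.inner_tmul, R₁.inner_orbit,
        R₂.inner_orbit, prod_star_tmul_mul_tmul_of_mem ω₁ ω₂ d ha hb hc]

theorem isPositiveFunctional_prod : IsPositiveFunctional (ω₁.prod ω₂) := fun x => by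
  have R₁ : GNSRep ω₁.toFun := .ofCStarAlgebra ω₁.isPositiveFunctional
  have R₂ : GNSRep ω₂.toFun := .ofCStarAlgebra ω₂.isPositiveFunctional
  rw [← inner_tensorOrbit ω₁ ω₂ R₁ R₂]
  exact Complex.nonneg_iff.mpr ⟨inner_self_nonneg (𝕜 := ℂ) (x := tensorOrbit ω₁ ω₂ R₁ R₂ x),
    (inner_self_im (𝕜 := ℂ) (tensorOrbit ω₁ ω₂ R₁ R₂ x)).symm⟩

theorem exists_gnsNorm_prod_mul_le (x : FermiProduct g₁ g₂) : ∃ C : ℝ, 0 ≤ C ∧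
    ∀ (ω₁ : EvenState g₁) (ω₂ : EvenState g₂) (y : FermiProduct g₁ g₂),
      gnsNorm (ω₁.prod ω₂) (x * y) ≤ C * gnsNorm (ω₁.prod ω₂) y := by
  induction x using induction_homogeneous with
  | hadd x x' hx hx' =>
    obtain ⟨C, hC, h⟩ := hx
    obtain ⟨C', hC', h'⟩ := hx'
    refine ⟨C + C', add_nonneg hC hC', fun ω₁ ω₂ y => ?_⟩
    rw [add_mul, add_mul]
    exact ((isPositiveFunctional_prod ω₁ ω₂).gnsNorm_add_le _ _).trans
      (add_le_add (h ω₁ ω₂ y) (h' ω₁ ω₂ y))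
  | hmul _ _ a b _ _ =>
    refine ⟨‖a‖ * ‖b‖, by positivity, fun ω₁ ω₂ y => ?_⟩
    have hprod := isPositiveFunctional_prod ω₁ ω₂
    rw [← inclLeft_mul_inclRight, mul_assoc, mul_assoc]
    exact (hprod.gnsNorm_map_mul_le (inclLeft g₁ g₂) a _).trans
      (mul_le_mul_of_nonneg_left (hprod.gnsNorm_map_mul_le (inclRight g₁ g₂) b y) (norm_nonneg a))

/-- The GNS representation of the product of two even states. -/
def prodGNSRep : GNSRep (ω₁.prod ω₂) :=
  .ofIsPositiveFunctional (isPositiveFunctional_prod ω₁ ω₂) fun x =>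
    let ⟨C, _, h⟩ := exists_gnsNorm_prod_mul_le x
    ⟨C, h ω₁ ω₂⟩

instance : Nontrivial (prodGNSRep ω₁ ω₂).H := by
  refine ⟨(prodGNSRep ω₁ ω₂).ξ, 0, fun h => ?_⟩
  have h1 := (prodGNSRep ω₁ ω₂).inner_eq 1
  rw [prod_one, h, inner_zero_left] at h1
  exact zero_ne_one h1

end EvenState

/-! ### The spatial norm -/

section LpProduct

open scoped ENNReal

variable {I : Type*} {A : I → Type*} [∀ i, CStarAlgebra (A i)] [∀ i, Nontrivial (A i)]

instance lpCStarAlgebra : CStarAlgebra (lp A ∞) where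

variable {B : Type*} [Ring B] [StarRing B] [Algebra ℂ B]

/-- The direct sum of a pointwise bounded family of `*`-homomorphisms, with values in the bounded
families. -/
def boundedPi (π : ∀ i, B →⋆ₐ[ℂ] A i)
    (hπ : ∀ x, ∃ C : ℝ, ∀ i, ‖π i x‖ ≤ C) : B →⋆ₐ[ℂ] lp A ∞ where
  toFun x := ⟨fun i => π i x, memℓp_infty <| let ⟨C, hC⟩ := hπ x
    ⟨C, Set.forall_mem_range.mpr hC⟩⟩
  map_one' := by ext i; simp
  map_mul' x y := by ext i; simp
  map_zero' := by ext i; simp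
  map_add' x y := by ext i; exact map_add (π i) x y
  commutes' r := by ext i; simp [Algebra.algebraMap_eq_smul_one]
  map_star' x := by ext i; exact map_star (π i) x

theorem norm_boundedPi (π : ∀ i, B →⋆ₐ[ℂ] A i)
    (hπ : ∀ x, ∃ C : ℝ, ∀ i, ‖π i x‖ ≤ C) (x : B) : ‖boundedPi π hπ x‖ = ⨆ i, ‖π i x‖ :=
  lp.norm_eq_ciSup _

end LpProduct

section Completion

variable {B : Type u} [Ring B] [StarRing B] [Algebra ℂ B]

namespace CStarCompletion

/-- The closure of the range of a `*`-homomorphism, as a completion for the pulled-back norm. -/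
def ofStarAlgHom {D : Type u} [CStarAlgebra D] (f : B →⋆ₐ[ℂ] D) {N : B → ℝ}
    (hN : ∀ x, ‖f x‖ = N x) : CStarCompletion N :=
  haveI : IsClosed (f.range.topologicalClosure : Set D) :=
    StarSubalgebra.isClosed_topologicalClosure _
  have hf (x : B) : f x ∈ f.range.topologicalClosure :=
    StarSubalgebra.le_topologicalClosure _ (Set.mem_range_self x)
  { C := f.range.topologicalClosure
    ι := StarAlgHom.codRestrict f _ hf
    norm_ι := hN
    dense := by
      rw [DenseRange, Subtype.dense_iff, ← Set.range_comp]
      exact subset_rfl }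

variable {N : B → ℝ} (K : CStarCompletion N) (σ : B →⋆ₐ[ℂ] B)

/-- The continuous extension to the completion of a `*`-endomorphism `σ` of the algebra; it extends
`σ` if `σ` preserves the norm. -/
def extend : K.C →L[ℂ] K.C :=
  (K.ι.toLinearMap ∘ₗ σ.toLinearMap).extendOfNorm K.ι.toLinearMap

variable {σ}

theorem extend_ι (hσ : ∀ x, N (σ x) = N x) (x : B) : K.extend σ (K.ι x) = K.ι (σ x) :=
  LinearMap.extendOfNorm_eq K.dense ⟨1, fun x => by
    change ‖K.ι (σ x)‖ ≤ 1 * ‖K.ι x‖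
    rw [K.norm_ι, K.norm_ι, hσ, one_mul]⟩ x

theorem extend_extend (hσ : ∀ x, N (σ x) = N x) (hσσ : Function.Involutive σ) (x : K.C) :
    K.extend σ (K.extend σ x) = x := by
  induction x using K.dense.induction_on with
  | hp => apply isClosed_eq <;> fun_prop
  | ih x => rw [K.extend_ι hσ, K.extend_ι hσ, hσσ]

theorem extend_mul (hσ : ∀ x, N (σ x) = N x) (x y : K.C) :
    K.extend σ (x * y) = K.extend σ x * K.extend σ y := by
  induction x, y using K.dense.induction_on₂ with
  | hp => apply isClosed_eq <;> fun_prop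
  | h x y => rw [← map_mul, K.extend_ι hσ, K.extend_ι hσ, K.extend_ι hσ, map_mul, map_mul]

theorem extend_star (hσ : ∀ x, N (σ x) = N x) (x : K.C) :
    K.extend σ (star x) = star (K.extend σ x) := by
  induction x using K.dense.induction_on with
  | hp => apply isClosed_eq <;> fun_prop
  | ih x => rw [← map_star, K.extend_ι hσ, K.extend_ι hσ, map_star, map_star]

/-- The extension of a norm-preserving involutive `*`-endomorphism to a `*`-automorphism of the
completion. -/
def extendEquiv (hσ : ∀ x, N (σ x) = N x) (hσσ : Function.Involutive σ) : K.C ≃⋆ₐ[ℂ] K.C where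
  toFun := K.extend σ
  invFun := K.extend σ
  left_inv := K.extend_extend hσ hσσ
  right_inv := K.extend_extend hσ hσσ
  map_mul' := K.extend_mul hσ
  map_add' := map_add (K.extend σ)
  map_star' := K.extend_star hσ
  map_smul' := map_smul (K.extend σ)

end CStarCompletion

theorem isCStarNorm_of_norm_map {D : Type*} [CStarAlgebra D] (f : B →⋆ₐ[ℂ] D) {N : B → ℝ}
    (hN : ∀ x, ‖f x‖ = N x) (h0 : ∀ x, N x = 0 → x = 0) : IsCStarNorm N where
  add_le x y := by
    simpa only [← hN, map_add] using norm_add_le (f x) (f y)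
  smul_eq c x := by
    simpa only [← hN, map_smul] using norm_smul c (f x)
  eq_zero := h0
  mul_le x y := by
    simpa only [← hN, map_mul] using norm_mul_le (f x) (f y)
  star_mul_self x := by
    rw [← hN, ← hN, map_mul, map_star, CStarRing.norm_star_mul_self, sq]

end Completion

namespace FermiProduct

variable {A₁ : Type u} {A₂ : Type v} [CStarAlgebra A₁] [CStarAlgebra A₂]

variable (g₁ : Z2Grading A₁) (g₂ : Z2Grading A₂)

theorem exists_norm_π_le (x : FermiProduct g₁ g₂) : ∃ C : ℝ,
    ∀ p : EvenState g₁ × EvenState g₂, ‖(p.1.prodGNSRep p.2).π x‖ ≤ C := by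
  obtain ⟨C, hC, h⟩ := EvenState.exists_gnsNorm_prod_mul_le x
  exact ⟨C, fun p => GNSRep.norm_π_le _ hC (h p.1 p.2)⟩

theorem spatialNorm_eq_iSup (x : FermiProduct g₁ g₂) :
    spatialNorm g₁ g₂ x =
      ⨆ p : EvenState g₁ × EvenState g₂, ‖(p.1.prodGNSRep p.2).π x‖ := by
  refine congrArg sSup (Set.ext fun r => ⟨?_, ?_⟩)
  · rintro ⟨ω₁, ω₂, R, rfl⟩
    exact ⟨(ω₁, ω₂), GNSRep.norm_π_eq _ _ x⟩
  · rintro ⟨p, rfl⟩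
    exact ⟨p.1, p.2, _, rfl⟩

variable {g₁ g₂}

theorem norm_π_le_spatialNorm {ω₁ : EvenState g₁} {ω₂ : EvenState g₂} (R : GNSRep (ω₁.prod ω₂))
    (x : FermiProduct g₁ g₂) : ‖R.π x‖ ≤ spatialNorm g₁ g₂ x := by
  rw [spatialNorm_eq_iSup, R.norm_π_eq (ω₁.prodGNSRep ω₂)]
  obtain ⟨C, hC⟩ := exists_norm_π_le g₁ g₂ x
  exact le_ciSup (f := fun p : EvenState g₁ × EvenState g₂ => ‖(p.1.prodGNSRep p.2).π x‖)
    ⟨C, Set.forall_mem_range.mpr hC⟩ (ω₁, ω₂)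

theorem gnsNorm_prod_grading (ω₁ : EvenState g₁) (ω₂ : EvenState g₂) (x : FermiProduct g₁ g₂) :
    gnsNorm (ω₁.prod ω₂) (grading g₁ g₂ x) = gnsNorm (ω₁.prod ω₂) x := by
  rw [gnsNorm, gnsNorm, ← grading_star, ← grading_mul, EvenState.prod_grading]

theorem norm_π_grading_le {ω₁ : EvenState g₁} {ω₂ : EvenState g₂} (R : GNSRep (ω₁.prod ω₂))
    (x : FermiProduct g₁ g₂) : ‖R.π (grading g₁ g₂ x)‖ ≤ ‖R.π x‖ :=
  R.norm_π_le (norm_nonneg _) fun y => by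
    have h := R.gnsNorm_mul_le x (grading g₁ g₂ y)
    rwa [gnsNorm_prod_grading, ← gnsNorm_prod_grading, grading_mul, grading_grading] at h

theorem spatialNorm_grading (x : FermiProduct g₁ g₂) :
    spatialNorm g₁ g₂ (grading g₁ g₂ x) = spatialNorm g₁ g₂ x := by
  rw [spatialNorm_eq_iSup, spatialNorm_eq_iSup]
  refine iSup_congr fun p => le_antisymm (norm_π_grading_le _ x) ?_
  simpa only [grading_grading] using norm_π_grading_le (p.1.prodGNSRep p.2) (grading g₁ g₂ x)

/-- The slice `a ⊗ b ↦ f b • a` of the Fermi product. -/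
def slice (f : A₂ →ₗ[ℂ] ℂ) : FermiProduct g₁ g₂ →ₗ[ℂ] A₁ :=
  (TensorProduct.rid ℂ A₁).toLinearMap ∘ₗ TensorProduct.map LinearMap.id f ∘ₗ
    (ofTensor g₁ g₂).symm.toLinearMap

theorem slice_tmul (f : A₂ →ₗ[ℂ] ℂ) (a : A₁) (b : A₂) :
    slice f (ofTensor g₁ g₂ (a ⊗ₜ b)) = f b • a := rfl

theorem prod_star_tmul_mul (ω₁ : EvenState g₁) (ω₂ : EvenState g₂) (a : A₁) (b : A₂)
    (x : FermiProduct g₁ g₂) :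
    ω₁.prod ω₂ (star (ofTensor g₁ g₂ (a ⊗ₜ b)) * x) =
      ω₁.toFun (star a * slice (ω₂.toFun ∘ₗ LinearMap.mulLeft ℂ (star b)) x) := by
  let R₁ : GNSRep ω₁.toFun := .ofCStarAlgebra ω₁.isPositiveFunctional
  let R₂ : GNSRep ω₂.toFun := .ofCStarAlgebra ω₂.isPositiveFunctional
  rw [← EvenState.inner_tensorOrbit ω₁ ω₂ R₁ R₂]
  induction x using induction_homogeneous with
  | hadd x y hx hy => rw [map_add, map_add, mul_add, map_add, inner_add_right, hx, hy]
  | hmul _ _ c d _ _ =>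
    rw [EvenState.tensorOrbit_tmul, EvenState.tensorOrbit_tmul, TensorProduct.inner_tmul,
      GNSRep.inner_orbit, GNSRep.inner_orbit, slice_tmul, mul_smul_comm, map_smul, smul_eq_mul,
      mul_comm, LinearMap.comp_apply, LinearMap.mulLeft_apply]

theorem eq_zero_of_forall_slice_eq_zero {x : FermiProduct g₁ g₂}
    (hx : ∀ (ω : EvenState g₂) (b : A₂), slice (ω.toFun ∘ₗ LinearMap.mulLeft ℂ (star b)) x = 0) :
    x = 0 := by
  obtain ⟨t, rfl⟩ := (ofTensor g₁ g₂).surjective x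
  let e := Module.Basis.ofVectorSpace ℂ A₁
  obtain ⟨b, rfl⟩ := TensorProduct.eq_repr_basis_left e t
  suffices hb : b = 0 by simp [hb]
  ext i
  by_contra hne
  obtain ⟨ω, hω⟩ := EvenState.exists_map_star_mul_self_ne_zero g₂ hne
  have hslice := hx ω (b i)
  rw [Finsupp.sum, map_sum, map_sum] at hslice
  simp only [slice_tmul] at hslice
  exact hω (linearIndependent_iff'.mp e.linearIndependent _ _ hslice i
    (Finsupp.mem_support_iff.mpr hne))

theorem eq_zero_of_forall_prod_star_mul_eq_zero {x : FermiProduct g₁ g₂}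
    (hx : ∀ (ω₁ : EvenState g₁) (ω₂ : EvenState g₂) (y : FermiProduct g₁ g₂),
      ω₁.prod ω₂ (star y * x) = 0) : x = 0 := by
  refine eq_zero_of_forall_slice_eq_zero fun ω₂ b => ?_
  by_contra hne
  obtain ⟨ω₁, hω₁⟩ := EvenState.exists_map_star_mul_self_ne_zero g₁ hne
  exact hω₁ (by rw [← prod_star_tmul_mul, hx])

theorem eq_zero_of_spatialNorm_eq_zero {x : FermiProduct g₁ g₂}
    (hx : spatialNorm g₁ g₂ x = 0) : x = 0 := by
  refine eq_zero_of_forall_prod_star_mul_eq_zero fun ω₁ ω₂ y => ?_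
  have hπ : (ω₁.prodGNSRep ω₂).π x = 0 :=
    norm_le_zero_iff.mp ((norm_π_le_spatialNorm _ x).trans hx.le)
  rw [← (ω₁.prodGNSRep ω₂).inner_orbit, ← mul_one x, ← GNSRep.π_orbit, hπ,
    zero_apply, inner_zero_right]

variable (g₁ g₂) in
theorem isCompatibleNorm_spatialNorm : IsCompatibleNorm (spatialNorm g₁ g₂) := by
  have hnorm := norm_boundedPi
    (fun p : EvenState g₁ × EvenState g₂ => (p.1.prodGNSRep p.2).π) (exists_norm_π_le g₁ g₂)
  simp only [← spatialNorm_eq_iSup] at hnorm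
  let K := CStarCompletion.ofStarAlgHom _ hnorm
  exact ⟨isCStarNorm_of_norm_map _ hnorm fun _ => eq_zero_of_spatialNorm_eq_zero,
    K, K.extendEquiv (σ := gradingHom g₁ g₂) spatialNorm_grading grading_grading,
    K.extend_ι spatialNorm_grading⟩

end FermiProduct

/-! ### Minimality of the spatial norm -/

section MulRightComp

variable {A C : Type*} [Ring A] [StarRing A] [Algebra ℂ A] [Ring C] [StarRing C] [Algebra ℂ C]

/-- The functional `a ↦ φ (i(a) y)`: the functional `φ(· y)` pulled back along `i`. -/
def mulRightComp (i : A →⋆ₐ[ℂ] C) (φ : C →ₗ[ℂ] ℂ) (y : C) : A →ₗ[ℂ] ℂ :=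
  φ ∘ₗ LinearMap.mulRight ℂ y ∘ₗ (i : A →ₗ[ℂ] C)

variable {i : A →⋆ₐ[ℂ] C} {φ : C →ₗ[ℂ] ℂ}

theorem mulRightComp_apply (y : C) (a : A) : mulRightComp i φ y a = φ (i a * y) := rfl

theorem gnsNorm_map_of_comp_eq {ψ : A →ₗ[ℂ] ℂ} (hψ : ∀ a, φ (i a) = ψ a) (a : A) :
    gnsNorm φ (i a) = gnsNorm ψ a := by
  rw [gnsNorm, gnsNorm, ← map_star, ← map_mul, hψ]

variable [StarModule ℂ C] {B : Type*} [CStarAlgebra B]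

theorem IsPositiveFunctional.mulRightComp_mem_gnsBounded (hφ : IsPositiveFunctional φ)
    (j : B →⋆ₐ[ℂ] C) {ψ χ : A →ₗ[ℂ] ℂ} (hψ : ∀ a, φ (i a) = ψ a) {σ : A → A}
    (hχ : ∀ a, gnsNorm χ a = gnsNorm ψ (σ a)) {b : B} (hb : ∀ a, i a * j b = j b * i (σ a)) :
    mulRightComp i φ (j b) ∈ gnsBounded ψ χ := by
  refine ⟨‖b‖, fun a c => ?_⟩
  calc ‖mulRightComp i φ (j b) (star a * c)‖
      = ‖φ (star (i a) * (j b * i (σ c)))‖ := by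
        rw [mulRightComp_apply, map_mul i, map_star, mul_assoc, hb]
    _ ≤ gnsNorm φ (i a) * gnsNorm φ (j b * i (σ c)) := hφ.norm_map_star_mul_le _ _
    _ ≤ gnsNorm φ (i a) * (‖b‖ * gnsNorm φ (i (σ c))) :=
        mul_le_mul_of_nonneg_left (hφ.gnsNorm_map_mul_le j b _) (gnsNorm_nonneg φ _)
    _ = ‖b‖ * (gnsNorm ψ a * gnsNorm χ c) := by
        rw [gnsNorm_map_of_comp_eq hψ, gnsNorm_map_of_comp_eq hψ, hχ, mul_left_comm]

end MulRightComp

namespace Z2Grading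

variable {A : Type*} [CStarAlgebra A] (g : Z2Grading A)

/-- The even elements, as a `C*`-subalgebra. -/
def evenSubalgebra : StarSubalgebra ℂ A :=
  StarAlgHom.equalizer (g.theta : A →⋆ₐ[ℂ] A) (.id ℂ A)

theorem mem_evenSubalgebra {a : A} : a ∈ g.evenSubalgebra ↔ a ∈ g.component 0 := Iff.rfl

instance : IsClosed (g.evenSubalgebra : Set A) :=
  isClosed_eq (StarAlgEquiv.isometry g.theta).continuous continuous_id

end Z2Grading

namespace FermiProduct

variable {A₁ : Type u} {A₂ : Type v} [CStarAlgebra A₁] [CStarAlgebra A₂]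
  {g₁ : Z2Grading A₁} {g₂ : Z2Grading A₂}

theorem ofTensor_tmul_ne_zero {a : A₁} {b : A₂} (ha : a ≠ 0) (hb : b ≠ 0) :
    ofTensor g₁ g₂ (a ⊗ₜ b) ≠ 0 := by
  intro h
  obtain ⟨ω, hω⟩ := EvenState.exists_map_star_mul_self_ne_zero g₂ hb
  have hslice := congrArg (slice (ω.toFun ∘ₗ LinearMap.mulLeft ℂ (star b))) h
  rw [slice_tmul, map_zero] at hslice
  exact smul_ne_zero hω ha hslice

variable {N : FermiProduct g₁ g₂ → ℝ} (K : CStarCompletion N)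

/-- The inclusion of the first factor into a completion. -/
def completionLeft : A₁ →⋆ₐ[ℂ] K.C := K.ι.comp (inclLeft g₁ g₂)

/-- The inclusion of the second factor into a completion. -/
def completionRight : A₂ →⋆ₐ[ℂ] K.C := K.ι.comp (inclRight g₁ g₂)

variable {K}

theorem completionLeft_mul_completionRight (a : A₁) (b : A₂) :
    completionLeft K a * completionRight K b = K.ι (ofTensor g₁ g₂ (a ⊗ₜ b)) := by
  rw [← inclLeft_mul_inclRight, map_mul]
  rfl

theorem commute_completionLeft_completionRight (a : A₁) {b : A₂} (hb : b ∈ g₂.component 0) :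
    Commute (completionLeft K a) (completionRight K b) :=
  (commute_inclLeft_inclRight a hb).map K.ι

theorem completionLeft_mul_completionRight_of_odd (a : A₁) {b : A₂} (hb : b ∈ g₂.component 1) :
    completionLeft K a * completionRight K b =
      completionRight K b * completionLeft K (g₁.theta a) := by
  have h := congrArg K.ι (inclRight_mul_inclLeft_of_odd (g₁.theta a) hb)
  rw [g₁.involutive, map_mul, map_mul] at h
  exact h.symm

theorem schliederPair_completion (hN : IsCStarNorm N) :
    SchliederPair (completionLeft K) ((completionRight K).comp g₂.evenSubalgebra.subtype) where
  commute a b := commute_completionLeft_completionRight a (g₂.mem_evenSubalgebra.mp b.2)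
  mul_ne_zero {a b} ha hb h := by
    refine ofTensor_tmul_ne_zero (g₁ := g₁) (g₂ := g₂) ha (Subtype.coe_ne_coe.mpr hb)
      (hN.eq_zero _ ?_)
    rw [← K.norm_ι, ← completionLeft_mul_completionRight, norm_eq_zero]
    exact h

/-- The grading of a completion by an extension of `θ₁ Ⓕ θ₂`. -/
def completionGrading {Θ : K.C ≃⋆ₐ[ℂ] K.C} (hΘ : ∀ x, Θ (K.ι x) = K.ι (grading g₁ g₂ x)) :
    Z2Grading K.C where
  theta := Θ
  involutive x := by
    induction x using K.dense.induction_on with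
    | hp =>
      have hcont : Continuous Θ := (StarAlgEquiv.isometry Θ).continuous
      exact isClosed_eq (hcont.comp hcont) continuous_id
    | ih x => rw [hΘ, hΘ, grading_grading]

theorem mulRightComp_completion_of_even {ψ : State A₁} (hψ : ψ.IsExtreme) (ω₂ : EvenState g₂)
    {Ω : State K.C} (hΩψ : ∀ a, Ω.toFun (completionLeft K a) = ψ.toFun a) {b : A₂}
    (hb : b ∈ g₂.component 0) (hΩb : Ω.toFun (completionRight K b) = ω₂.toFun b) :
    mulRightComp (completionLeft K) Ω.toFun (completionRight K b) = ω₂.toFun b • ψ.toFun := by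
  rw [hψ.eq_smul (fun _ => rfl) (Ω.isPositiveFunctional.mulRightComp_mem_gnsBounded
    (completionRight K) hΩψ (σ := id) (fun _ => rfl)
    fun a => commute_completionLeft_completionRight a hb), mulRightComp_apply, map_one, one_mul,
    hΩb]

theorem mulRightComp_completion_of_odd {ψ : State A₁} (hψ : ψ.IsExtreme)
    (hω₁ : (ψ.average g₁).IsExtreme) {Ω : State K.C}
    (hΩψ : ∀ a, Ω.toFun (completionLeft K a) = ψ.toFun a) {a : A₁} (ha : a ∈ g₁.component 1)
    {b : A₂} (hb : b ∈ g₂.component 1) :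
    mulRightComp (completionLeft K) Ω.toFun (completionRight K b) a = 0 :=
  State.map_eq_zero_of_mem_gnsBounded_comp_thetaLin hψ hω₁
    (Ω.isPositiveFunctional.mulRightComp_mem_gnsBounded (completionRight K) hΩψ
      (gnsNorm_comp_thetaLin ψ.toFun) fun a => completionLeft_mul_completionRight_of_odd a hb) ha

theorem exists_evenState_extension_of_isExtreme {Θ : K.C ≃⋆ₐ[ℂ] K.C}
    (hΘ : ∀ x, Θ (K.ι x) = K.ι (grading g₁ g₂ x)) (hN : IsCStarNorm N) {ω₁ : EvenState g₁}
    (hω₁ : ω₁.IsExtreme) (ω₂ : EvenState g₂) :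
    ∃ Ω : EvenState (completionGrading hΘ), ∀ x, Ω.toFun (K.ι x) = ω₁.prod ω₂ x := by
  obtain ⟨ψ, hψ, rfl⟩ := hω₁.exists_pure_average_eq
  obtain ⟨Ω, hΩψ, hΩω₂⟩ := (schliederPair_completion (K := K) hN).exists_joint_extension ψ
    (ω₂.comap g₂.evenSubalgebra.subtype)
  have hF (a : A₁) (b : A₂) : Ω.toFun (K.ι (ofTensor g₁ g₂ (a ⊗ₜ b))) =
      mulRightComp (completionLeft K) Ω.toFun (completionRight K b) a := by
    rw [← completionLeft_mul_completionRight, mulRightComp_apply]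
  have heven (a : A₁) {b : A₂} (hb : b ∈ g₂.component 0) :
      Ω.toFun (K.ι (ofTensor g₁ g₂ (a ⊗ₜ b))) = ω₂.toFun b * ψ.toFun a := by
    rw [hF, mulRightComp_completion_of_even hψ ω₂ hΩψ hb (hΩω₂ ⟨b, hb⟩), LinearMap.smul_apply,
      smul_eq_mul]
  refine ⟨Ω.average _, fun x => ?_⟩
  induction x using induction_homogeneous with
  | hadd x y hx hy => rw [map_add, map_add, map_add, hx, hy]
  | hmul i j a b ha hb =>
    have haverage : (Ω.average (completionGrading hΘ)).toFun (K.ι (ofTensor g₁ g₂ (a ⊗ₜ b))) =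
        2⁻¹ * (Ω.toFun (K.ι (ofTensor g₁ g₂ (a ⊗ₜ b))) +
          Ω.toFun (K.ι (ofTensor g₁ g₂ (g₁.theta a ⊗ₜ g₂.theta b)))) := by
      rw [State.average_apply, ← grading_tmul, ← hΘ]
      rfl
    rw [haverage, EvenState.prod_tmul]
    rcases zmod_two_cases j with rfl | rfl
    · rw [heven a hb, heven _ (g₂.theta_mem hb), ω₂.even, State.average_apply]
      ring
    · rw [ω₂.map_eq_zero_of_mem hb, mul_zero]
      rcases zmod_two_cases i with rfl | rfl
      · rw [g₁.mem_component.mp ha, g₂.mem_component.mp hb]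
        simp [TensorProduct.tmul_neg]
      · rw [hF, hF, mulRightComp_completion_of_odd hψ hω₁ hΩψ ha hb,
          mulRightComp_completion_of_odd hψ hω₁ hΩψ (g₁.theta_mem ha) (g₂.theta_mem hb), add_zero,
          mul_zero]

theorem norm_prod_le {Θ : K.C ≃⋆ₐ[ℂ] K.C} (hΘ : ∀ x, Θ (K.ι x) = K.ι (grading g₁ g₂ x))
    (hN : IsCStarNorm N) (ω₁ : EvenState g₁) (ω₂ : EvenState g₂) (x : FermiProduct g₁ g₂) :
    ‖ω₁.prod ω₂ x‖ ≤ N x := by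
  obtain ⟨s, hs⟩ := TensorProduct.exists_finset ((ofTensor g₁ g₂).symm x)
  let T : (A₁ → ℂ) →L[ℝ] ℂ := ∑ p ∈ s, ω₂.toFun p.2 • ContinuousLinearMap.proj p.1
  have hT (ω : EvenState g₁) : T ω.toFun = ω.prod ω₂ x := by
    rw [← (ofTensor g₁ g₂).apply_symm_apply x, hs, map_sum, map_sum]
    simp [T, EvenState.prod_tmul, mul_comm]
  suffices hmem : ⇑ω₁.toFun ∈ T ⁻¹' Metric.closedBall 0 (N x) by
    rwa [Set.mem_preimage, mem_closedBall_zero_iff, hT] at hmem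
  refine EvenState.mem_of_forall_isExtreme_mem (Metric.isClosed_closedBall.preimage T.continuous)
    ((convex_closedBall 0 (N x)).linear_preimage T.toLinearMap) (fun ω hω => ?_) ω₁
  obtain ⟨Ω, hΩ⟩ := exists_evenState_extension_of_isExtreme hΘ hN hω ω₂
  rw [Set.mem_preimage, mem_closedBall_zero_iff, hT, ← hΩ, ← K.norm_ι]
  exact Ω.norm_map_le _

end FermiProduct

namespace CStarCompletion

variable {B : Type u} [Ring B] [StarRing B] [Algebra ℂ B] {N : B → ℝ} (K : CStarCompletion N)
  {φ : B →ₗ[ℂ] ℂ}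

theorem exists_isPositiveFunctional_extension (hφ : IsPositiveFunctional φ)
    (hle : ∀ x, ‖φ x‖ ≤ N x) :
    ∃ Ω : K.C →ₗ[ℂ] ℂ, IsPositiveFunctional Ω ∧ ∀ x, Ω (K.ι x) = φ x := by
  obtain ⟨Ω, hΩ, -⟩ := exists_continuousLinearMap_comp_eq (L := K.ι.toLinearMap) (f := φ)
    fun x => (hle x).trans_eq (K.norm_ι x).symm
  refine ⟨Ω.toLinearMap, fun y => ?_, hΩ⟩
  change 0 ≤ Ω (star y * y)
  induction y using K.dense.induction_on with
  | hp => exact isClosed_le (by fun_prop) (by fun_prop)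
  | ih x =>
    rw [← map_star, ← map_mul]
    exact (hφ x).trans_eq (hΩ _).symm

end CStarCompletion

theorem GNSRep.norm_π_le_of_norm_le {B : Type u} [Ring B] [StarRing B] [Algebra ℂ B] {N : B → ℝ}
    (K : CStarCompletion N) {φ : B →ₗ[ℂ] ℂ} (hφ : IsPositiveFunctional φ)
    (hle : ∀ x, ‖φ x‖ ≤ N x) (R : GNSRep φ) (x : B) : ‖R.π x‖ ≤ N x := by
  obtain ⟨Ω, hΩ, hΩφ⟩ := K.exists_isPositiveFunctional_extension hφ hle
  rw [← K.norm_ι]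
  refine R.norm_π_le (norm_nonneg _) fun y => ?_
  simpa only [← map_mul, gnsNorm_map_of_comp_eq hΩφ] using hΩ.gnsNorm_mul_le (K.ι x) (K.ι y)

theorem FermiProduct.spatialNorm_le {A₁ : Type u} {A₂ : Type v} [CStarAlgebra A₁] [CStarAlgebra A₂]
    {g₁ : Z2Grading A₁} {g₂ : Z2Grading A₂} {N : FermiProduct g₁ g₂ → ℝ} (hN : IsCompatibleNorm N)
    (x : FermiProduct g₁ g₂) : spatialNorm g₁ g₂ x ≤ N x := by
  obtain ⟨hN, K, Θ, hΘ⟩ := hN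
  refine Real.sSup_le ?_ ((norm_nonneg _).trans_eq (K.norm_ι x))
  rintro _ ⟨ω₁, ω₂, R, rfl⟩
  exact R.norm_π_le_of_norm_le K (EvenState.isPositiveFunctional_prod ω₁ ω₂)
    (norm_prod_le hΘ hN ω₁ ω₂) x

end

theorem mainTheorem1 {A₁ : Type u} {A₂ : Type v} [CStarAlgebra A₁] [CStarAlgebra A₂]
    (g₁ : Z2Grading A₁) (g₂ : Z2Grading A₂) :
    -- every product of even states has a GNS representation, over which the supremum is taken
    (∀ (ω₁ : EvenState g₁) (ω₂ : EvenState g₂), Nonempty (GNSRep (ω₁.prod ω₂))) ∧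
    -- the spatial norm is a compatible C*-norm
    IsCompatibleNorm (FermiProduct.spatialNorm g₁ g₂) ∧
    -- and it is below every compatible C*-norm
    ∀ N : FermiProduct g₁ g₂ → ℝ, IsCompatibleNorm N →
      ∀ x : FermiProduct g₁ g₂, FermiProduct.spatialNorm g₁ g₂ x ≤ N x :=
  ⟨fun ω₁ ω₂ => ⟨ω₁.prodGNSRep ω₂⟩, FermiProduct.isCompatibleNorm_spatialNorm g₁ g₂,
    fun _ hN x => FermiProduct.spatialNorm_le hN x⟩
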